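/- **Theorem (Distance between column spaces).** Fix $K\ge 2$ and a sequence of pairwise distinct size vectors $(n_1,\dots,n_K)$ with $n_k\to\infty$ for all $k$ and $n_{\min}/n_{\max}=\min_k n_k/\max_k n_k\to c>0$; put $n=n_1+\dots+n_K$. *Model.* A random graph on $K$ clusters of sizes $n_1,\dots,n_K$ follows the random interconnection model (RIM) with probabilities $p_{ij}=p_{ji}\in[0,1]$ if cluster $k$ carries a deterministic, connected, otherwise arbitrary graph, and all pairs of nodes in different clusters are joined independently, with probability $p_{ij}$ for nodes in clusters $i\ne j$. It is homogeneous with parameter $p$ if $p_{ij}=p$ for all $i\neq j$. The Laplacian of a graph is $L=D-A$, $\lambda_i(L)$ is its $i$-th smallest eigenvalue, and a spectral-embedding matrix of $L$ is an $n\times(K-1)$ matrix with orthonormal columns that are orthogonal to $\mathbf 1_n$ and are eigenvectors of $L$ for $\lambda_2(L),\dots,\lambda_K(L)$. For two matrices $Y,\tilde Y\in\mathbb R^{n\times (K-1)}$ with orthonormal columns let $\Theta(Y,\tilde Y)=\mathrm{diag}(\arccos\sigma_1(Y^T\tilde Y),\dots,\arccos\sigma_{K-1}(Y^T\tilde Y))$,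 with $\sin$ taken entrywise. Along the sequence let $L$ be the Laplacian of a RIM graph with fixed probabilities $p_{ij}$ and, for each $p\in[0,1]$, let $\tilde L=\tilde L_p$ be the Laplacian of a homogeneous RIM graph with parameter $p$, the same cluster sizes and given internal cluster graphs not depending on $p$ (for example those of $L$), independent of $L$ for each size vector. All graphs live on one probability space; nothing else is assumed about their joint law. Let $p^*\in[0,1]$ be the critical threshold of this homogeneous RIM, that is, the supremum of the $q\in[0,1]$ such that for every $p\in[0,q]$, almost surely $\frac1n\sum_{k=2}^K\lambda_k(\tilde L_p)\to(K-1)p$ (whatever the joint law of the graphs for different size vectors). Let $\delta_{p,n}=\min\{p,|\lambda_{K+1}(L)/n-p|\}$. Call $p\in[0,1]$ admissible if almost surely $\delta_{p,n}\to\delta_p$ and $\|L-\tilde L_p\|_F/n\to b_p$ for constants $\delta_p>0$ and $b_p\in[0,\infty]$. 1. If $p<p^*$ is admissible, then almost surely, for all choices of spectral-embedding matrices $Y$ of $L$ and $\tilde Y$ of $\tilde L_p$, $$\limsup\ \|\sin\Theta(Y,\tilde Y)\|_F\le \frac{b_p}{\delta_p}.$$ 2. Let $p_{\max}=\max_{i\ne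 j}p_{ij}$. If $p_{\max}<p^*$, then for every $q\in[0,1]$ with $q<p^*$, almost surely, for all choices of spectral-embedding matrices $Y$ of $L$ and $\tilde Y$ of $\tilde L_q$, $$\limsup\ \|\sin\Theta(Y,\tilde Y)\|_F\le \inf\Big\{\frac{b_p}{\delta_p}:\ p\le p_{\max}\text{ admissible}\Big\}.$$ -/

import Mathlib

open MeasureTheory ProbabilityTheory Filter Topology Set
open scoped ENNReal Matrix

noncomputable section

/-- The node set of a graph with `K` clusters of sizes `s 0, …, s (K-1)`. -/
abbrev Nodes {K : ℕ} (s : Fin K → ℕ) : Type := Σ k : Fin K, Fin (s k)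

/-- The total number of nodes `n = n₁ + ⋯ + n_K`. -/
def numNodes {K : ℕ} (s : Fin K → ℕ) : ℕ := ∑ k, s k

/-- A random graph `Γ` follows the random interconnection model (RIM) with (deterministic,
connected, otherwise arbitrary) internal cluster graphs `G k` and interconnection probabilities
`P i j`: inside cluster `k` it is `G k`, and the edges between different clusters are mutually
independent, an edge between clusters `i` and `j` being present with probability `P i j`. -/
structure IsRIM {Ω : Type*} [MeasurableSpace Ω] (μ : Measure Ω) {K : ℕ} {s : Fin K → ℕ}
    (G : ∀ k, SimpleGraph (Fin (s k))) (P : Fin K → Fin K → ℝ)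
    (Γ : Ω → SimpleGraph (Nodes s)) : Prop where
  connected : ∀ k, (G k).Connected
  internal : ∀ ω k u v, (Γ ω).Adj ⟨k, u⟩ ⟨k, v⟩ ↔ (G k).Adj u v
  measurable : ∀ e f : Nodes s, e.1 < f.1 → MeasurableSet {ω | (Γ ω).Adj e f}
  bernoulli : ∀ e f : Nodes s, e.1 < f.1 →
    μ {ω | (Γ ω).Adj e f} = ENNReal.ofReal (P e.1 f.1)
  indep : iIndepSet
    (fun e : {e : Nodes s × Nodes s // e.1.1 < e.2.1} => {ω | (Γ ω).Adj e.1.1 e.1.2}) μ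

open Classical in
/-- The graph Laplacian `L = D - A`. -/
def laplacian {V : Type*} [Fintype V] [DecidableEq V] (G : SimpleGraph V) : Matrix V V ℝ :=
  G.lapMatrix ℝ

/-- `eigval M i` is the `i`-th smallest eigenvalue `λ_i(M)` (counted with multiplicity,
`i = 1, …, n`) of the real symmetric matrix `M`. -/
def eigval {V : Type*} [Fintype V] [DecidableEq V] (M : Matrix V V ℝ) (i : ℕ) : ℝ :=
  open Classical in
  if h : M.IsHermitian ∧ 1 ≤ i ∧ i ≤ Fintype.card V then
    h.1.eigenvalues₀ ⟨Fintype.card V - i, by omega⟩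
  else 0

/-- The partial eigenvalue sum `S_{2:K}(M) = λ_2(M) + ⋯ + λ_K(M)`. -/
def partialEigSum {V : Type*} [Fintype V] [DecidableEq V] (K : ℕ) (M : Matrix V V ℝ) : ℝ :=
  ∑ i ∈ Finset.Icc 2 K, eigval M i

/-- `Y` is a spectral-embedding matrix of the Laplacian `L`: its `K - 1` columns are orthonormal,
orthogonal to the all-ones vector, and are eigenvectors for `λ_2(L), …, λ_K(L)`. -/
structure IsSpectralEmbedding {V : Type*} [Fintype V] [DecidableEq V] {K : ℕ} (L : Matrix V V ℝ)
    (Y : Matrix V (Fin (K - 1)) ℝ) : Prop where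
  orthonormal : Yᵀ * Y = 1
  centered : Yᵀ *ᵥ (fun _ => 1) = 0
  eigen : L * Y = Y * Matrix.diagonal (fun j : Fin (K - 1) => eigval L (j.1 + 2))

/-- The Frobenius norm. -/
def frobNorm {m n : Type*} [Fintype m] [Fintype n] (M : Matrix m n ℝ) : ℝ :=
  √(∑ i, ∑ j, M i j ^ 2)

/-- `Θ(Y, Z) = diag(arccos σ_1(YᵀZ), …, arccos σ_r(YᵀZ))`, the diagonal matrix of principal
angles between the column spaces of two matrices with `r` orthonormal columns. -/
def principalAngles {V : Type*} [Fintype V] {r : ℕ} (Y Z : Matrix V (Fin r) ℝ) :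
    Matrix (Fin r) (Fin r) ℝ :=
  Matrix.diagonal fun k =>
    Real.arccos ((Matrix.toEuclideanLin (Yᵀ * Z)).singularValues k)

/-- `‖sin Θ(Y, Z)‖_F`, the sine being taken entrywise. -/
def sinThetaNorm {V : Type*} [Fintype V] {r : ℕ} (Y Z : Matrix V (Fin r) ℝ) : ℝ :=
  frobNorm ((principalAngles Y Z).map Real.sin)

/-- For the cluster sizes `N m k` and internal cluster graphs `H m k` (`m = 0, 1, …`), the value
`p` is subcritical if `S_{2:K}(L̃) / n → (K - 1) p` almost surely for homogeneous RIM graphs with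
parameter `p`, whatever the joint law of the graphs for different `m`. -/
def IsSubcritical {K : ℕ} (N : ℕ → Fin K → ℕ) (H : ∀ m k, SimpleGraph (Fin (N m k)))
    (p : ℝ) : Prop :=
  ∀ (Ω : Type) [MeasurableSpace Ω] (μ : Measure Ω) [IsProbabilityMeasure μ]
    (Γ : ∀ m, Ω → SimpleGraph (Nodes (N m))),
    (∀ m, IsRIM μ (H m) (fun _ _ => p) (Γ m)) →
    ∀ᵐ ω ∂μ, Tendsto (fun m => partialEigSum K (laplacian (Γ m ω)) / (numNodes (N m) : ℝ))
      atTop (𝓝 (((K : ℝ) - 1) * p))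

/-- The critical threshold `p* ∈ [0, 1]` of the homogeneous RIM: the value up to which
`S_{2:K}(L̃) / n` converges to `(K - 1) p`. -/
def criticalThreshold {K : ℕ} (N : ℕ → Fin K → ℕ) (H : ∀ m k, SimpleGraph (Fin (N m k))) : ℝ :=
  sSup {q : ℝ | q ∈ Icc (0 : ℝ) 1 ∧ ∀ p ∈ Icc (0 : ℝ) q, IsSubcritical N H p}

/-- `p_max = max_{i ≠ j} p_{ij}`. -/
def maxProb {K : ℕ} (P : Fin K → Fin K → ℝ) : ℝ :=
  ⨆ e : {e : Fin K × Fin K // e.1 ≠ e.2}, P e.1.1 e.1.2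

/-- `δ_{p,n} = min {p, |λ_{K+1}(L)/n - p|}` for a matrix `L` of size `n`. -/
def spectralGap {V : Type*} [Fintype V] [DecidableEq V] (K : ℕ) (L : Matrix V V ℝ) (p : ℝ) : ℝ :=
  min p |eigval L (K + 1) / (Fintype.card V : ℝ) - p|

/-- Almost surely, `δ_{p,n} → δ > 0` and `‖L - L̃‖_F / n → b ∈ [0, ∞]`, for random graphs `Γ m`
with Laplacians `L` and `Γt m` with Laplacians `L̃`. -/
def HasLimits {Ω : Type*} [MeasurableSpace Ω] (μ : Measure Ω) {K : ℕ} {N : ℕ → Fin K → ℕ}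
    (Γ Γt : ∀ m, Ω → SimpleGraph (Nodes (N m))) (p : ℝ) (b : ℝ≥0∞) (δ : ℝ) : Prop :=
  0 < δ ∧
  (∀ᵐ ω ∂μ, Tendsto (fun m => spectralGap K (laplacian (Γ m ω)) p) atTop (𝓝 δ)) ∧
  (∀ᵐ ω ∂μ, Tendsto (fun m => ENNReal.ofReal
      (frobNorm (laplacian (Γ m ω) - laplacian (Γt m ω)) / (numNodes (N m) : ℝ)))
    atTop (𝓝 b))

end

/-! Write `K = r + 1`. Both claims follow from one estimate, `ae_limsup_sinThetaNorm_le`, in which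
the embedding `Z` belongs to the homogeneous graph at `q`, while the bound `b / δ` is taken at a
possibly different subcritical `p`. Claim 1 is `p = q`. Claim 2 needs the freedom in `p` and a
minimizing sequence of admissible values.

Noise. For a homogeneous RIM, `xᵀ L̃ x` is an internal form that does not involve `p`, plus `p`
times the form of the complete multipartite graph, plus noise. Almost surely the noise is at most `ε
n ‖x‖²` for all `x` at once, eventually for every `ε > 0` (`ae_eventually_abs_sub_le`): Hoeffding
and a union bound control the cut norm and the degrees, the cut norm controls the operator norm, and
Borel–Cantelli applies because the size vectors are distinct.

Cluster-constant vectors. On them the internal form vanishes, so `λ_K ≤ (p + o(1)) n`. Below the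
threshold the sum `λ_2 + ⋯ + λ_K` is `(K - 1) p n + o(n)`, hence already `λ_2 = p n + o(n)`.
Comparing `q` with a larger subcritical `q'` shows that the internal form penalizes deviations from
cluster means strictly more than `q` does. Therefore the columns of `Z` are asymptotically constant
on clusters (`mul_weightedSq_le`), and so they nearly minimize the Rayleigh quotient of `L̃_p` for
every subcritical `p` (`IsNearMean.dotProduct_sub_le`).

Perturbation. A Davis–Kahan inequality that tolerates approximate eigenvectors
(`abs_sub_mul_sinThetaNorm_le`) bounds `|λ_{K+1}(L) - λ_2(L̃_p)| ‖sin Θ‖` by `‖L - L̃_p‖_F + o(n)`.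
Division by `n` gives the bound. -/

section SpectralCoordinates

/-! ### Sorted eigenbases and variational bounds for eigenvalues. -/

variable {V : Type*} [Fintype V] [DecidableEq V]

theorem eigval_eq_eigenvalues₀ {M : Matrix V V ℝ} (hM : M.IsHermitian) {i : ℕ} (h1 : 1 ≤ i)
    (h2 : i ≤ Fintype.card V) :
    eigval M i = hM.eigenvalues₀ ⟨Fintype.card V - i, by omega⟩ := by
  unfold eigval
  rw [dif_pos ⟨hM, h1, h2⟩]

theorem eigval_mono {M : Matrix V V ℝ} (hM : M.IsHermitian) {i j : ℕ} (h1 : 1 ≤ i) (hij : i ≤ j)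
    (h2 : j ≤ Fintype.card V) : eigval M i ≤ eigval M j := by
  rw [eigval_eq_eigenvalues₀ hM h1 (hij.trans h2), eigval_eq_eigenvalues₀ hM (h1.trans hij) h2]
  apply hM.eigenvalues₀_antitone
  rw [Fin.mk_le_mk]
  omega

/-- An orthonormal eigenbasis listed by increasing eigenvalues. -/
structure IsSortedEigenbasis (M : Matrix V V ℝ) (v : Fin (Fintype.card V) → V → ℝ) : Prop where
  orthonormal : ∀ i j, v i ⬝ᵥ v j = if i = j then 1 else 0
  eigen : ∀ i, M *ᵥ v i = eigval M (i.1 + 1) • v i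
  expand : ∀ x, x = ∑ i, (v i ⬝ᵥ x) • v i

theorem exists_isSortedEigenbasis {M : Matrix V V ℝ} (hM : M.IsHermitian) :
    ∃ v, IsSortedEigenbasis M v := by
  have hS := Matrix.isSymmetric_toEuclideanLin_iff.mpr hM
  have hn : Module.finrank ℝ (EuclideanSpace ℝ V) = Fintype.card V := finrank_euclideanSpace
  -- Mathlib lists eigenvalues in decreasing order, `eigval` in increasing order, whence the
  -- reversal.
  let b := (hS.eigenvectorBasis hn).reindex Fin.revPerm
  have hdot : ∀ x y : EuclideanSpace ℝ V, (x : V → ℝ) ⬝ᵥ (y : V → ℝ) = inner ℝ x y := by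
    intro x y
    simp [PiLp.inner_apply, dotProduct, mul_comm]
  refine ⟨fun i => (b i : V → ℝ), fun i j => ?_, fun i => ?_, fun x => ?_⟩
  · rw [hdot, b.inner_eq_ite]
  · have h := hS.apply_eigenvectorBasis hn (Fin.rev i)
    have h2 := congrArg (fun z : EuclideanSpace ℝ V => (z : V → ℝ)) h
    rw [eigval_eq_eigenvalues₀ hM (by omega) (by omega)]
    have h3 : (⟨Fintype.card V - (i.1 + 1), by omega⟩ : Fin (Fintype.card V)) = Fin.rev i := by
      ext; simp [Fin.rev]
    rw [h3]
    simp only [b, OrthonormalBasis.reindex_apply, Fin.revPerm_symm, Fin.revPerm_apply]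
    rw [Matrix.toLpLin_apply] at h2
    exact h2
  · have h := b.sum_repr' (WithLp.toLp 2 x)
    have h2 := congrArg (fun z : EuclideanSpace ℝ V => (z : V → ℝ)) h
    simp only [← hdot] at h2
    simpa using! h2.symm

namespace IsSortedEigenbasis

variable {M : Matrix V V ℝ} {v : Fin (Fintype.card V) → V → ℝ}

theorem dotProduct_eq (hv : IsSortedEigenbasis M v) (x y : V → ℝ) :
    x ⬝ᵥ y = ∑ i, (v i ⬝ᵥ x) * (v i ⬝ᵥ y) := by
  conv_lhs => rw [hv.expand x]
  rw [sum_dotProduct]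
  simp

theorem dotProduct_mulVec (hv : IsSortedEigenbasis M v) (hM : M.IsHermitian) (x : V → ℝ) (i) :
    v i ⬝ᵥ (M *ᵥ x) = eigval M (i.1 + 1) * (v i ⬝ᵥ x) := by
  have hT : Mᵀ = M := by rw [← Matrix.conjTranspose_eq_transpose_of_trivial]; exact hM
  rw [Matrix.dotProduct_mulVec, ← Matrix.mulVec_transpose, hT, hv.eigen, smul_dotProduct,
    smul_eq_mul]

/-- A vector orthogonal to eigenvectors for the `r` smallest eigenvalues is orthogonal to all
eigenvectors whose eigenvalue is smaller than the next one. -/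
theorem dotProduct_eq_zero (hv : IsSortedEigenbasis M v) (hM : M.IsHermitian) {r : ℕ}
    {u : Fin r → V → ℝ}
    (hu : ∀ i j, u i ⬝ᵥ u j = if i = j then 1 else 0)
    (hue : ∀ i, M *ᵥ u i = eigval M (i.1 + 1) • u i) {x : V → ℝ} (hx : ∀ i, u i ⬝ᵥ x = 0)
    (i : Fin (Fintype.card V)) (hi : eigval M (i.1 + 1) < eigval M (r + 1)) : v i ⬝ᵥ x = 0 := by
  have hlt : ∀ j : Fin (Fintype.card V), eigval M (j.1 + 1) < eigval M (r + 1) → j.1 < r := by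
    intro j hj
    by_contra! h
    exact absurd (eigval_mono hM (by omega) (by omega : r + 1 ≤ j.1 + 1) (by omega)) (not_le.2 hj)
  let S := {j : Fin (Fintype.card V) // eigval M (j.1 + 1) < eigval M (r + 1)}
  let w : S → V → ℝ := fun k => u ⟨k.1.1, hlt k.1 k.2⟩
  -- Eigenvectors for distinct eigenvalues are orthogonal, so each `w k` lies in the span of the `v
  -- j` with `j ∈ S`. The coordinate matrix is square, so orthonormal rows force orthonormal
  -- columns, and the expansion inverts: `v i` lies in the span of the `w k`. This covers repeated
  -- eigenvalues, where `u` and `v` may differ.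
  let C : Matrix S S ℝ := Matrix.of fun k j => v j.1 ⬝ᵥ w k
  have hw : ∀ k : S, w k = ∑ j : S, C k j • v j.1 := by
    intro k
    conv_lhs => rw [hv.expand (w k)]
    have h0 : ∀ j : Fin (Fintype.card V), (v j ⬝ᵥ w k) • v j ≠ 0 →
        eigval M (j.1 + 1) < eigval M (r + 1) := by
      intro j hj
      by_contra h
      refine hj ?_
      have h1 := hv.dotProduct_mulVec hM (w k) j
      rw [hue, dotProduct_smul, smul_eq_mul] at h1
      have h2 : eigval M (k.1.1 + 1) ≠ eigval M (j.1 + 1) := by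
        have := k.2
        intro h3
        exact h (h3 ▸ this)
      have h4 : v j ⬝ᵥ w k = 0 := by
        by_contra h5
        exact h2 (mul_right_cancel₀ h5 h1)
      rw [h4, zero_smul]
    rw [← Finset.sum_filter_of_ne fun j _ => h0 j]
    exact Finset.sum_subtype _ (by simp) _
  have hC : C * Cᵀ = 1 := by
    ext k l
    have h1 : w k ⬝ᵥ w l = if k = l then 1 else 0 := by
      rw [hu]
      exact if_congr ⟨fun h => Subtype.ext (Fin.ext (Fin.mk.inj h)), fun h => by rw [h]⟩ rfl rfl
    rw [Matrix.one_apply, ← h1]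
    conv_rhs => rw [hw k]
    rw [sum_dotProduct]
    simp [Matrix.mul_apply, C]
  have hC' : Cᵀ * C = 1 := mul_eq_one_comm.1 hC
  have hvi : v i = ∑ k : S, C k ⟨i, hi⟩ • w k := by
    have : ∑ k : S, C k ⟨i, hi⟩ • w k = ∑ j : S, (Cᵀ * C) ⟨i, hi⟩ j • v j.1 := by
      simp_rw [Matrix.mul_apply, Finset.sum_smul]
      rw [Finset.sum_comm]
      refine Finset.sum_congr rfl fun k _ => ?_
      conv_lhs => rw [hw k]
      rw [Finset.smul_sum]
      simp [smul_smul]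
    rw [this, hC']
    simp [Matrix.one_apply]
  rw [hvi, sum_dotProduct]
  refine Finset.sum_eq_zero fun k _ => ?_
  rw [smul_dotProduct, hx, smul_zero]

end IsSortedEigenbasis

theorem eigval_mul_dotProduct_self_le {M : Matrix V V ℝ} (hM : M.IsHermitian) {r : ℕ}
    {u : Fin r → V → ℝ}
    (hu : ∀ i j, u i ⬝ᵥ u j = if i = j then 1 else 0)
    (hue : ∀ i, M *ᵥ u i = eigval M (i.1 + 1) • u i) {x : V → ℝ} (hx : ∀ i, u i ⬝ᵥ x = 0) :
    eigval M (r + 1) * (x ⬝ᵥ x) ≤ x ⬝ᵥ M *ᵥ x := by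
  obtain ⟨v, hv⟩ := exists_isSortedEigenbasis hM
  rw [hv.dotProduct_eq x x, hv.dotProduct_eq x, Finset.mul_sum]
  refine Finset.sum_le_sum fun i _ => ?_
  rw [hv.dotProduct_mulVec hM]
  by_cases hi : eigval M (i.1 + 1) < eigval M (r + 1)
  · simp [hv.dotProduct_eq_zero hM hu hue hx i hi]
  · nlinarith [mul_self_nonneg (v i ⬝ᵥ x)]

/-- In eigencoordinates only eigenvalues at least `λ_{r+1}` contribute, and `t` lies below all of
them, so squaring preserves the order. -/
theorem sq_mul_dotProduct_self_le {M : Matrix V V ℝ} (hM : M.IsHermitian) {r : ℕ}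
    {u : Fin r → V → ℝ}
    (hu : ∀ i j, u i ⬝ᵥ u j = if i = j then 1 else 0)
    (hue : ∀ i, M *ᵥ u i = eigval M (i.1 + 1) • u i) {x : V → ℝ} (hx : ∀ i, u i ⬝ᵥ x = 0)
    {t : ℝ} (ht : t ≤ eigval M (r + 1)) :
    (eigval M (r + 1) - t) ^ 2 * (x ⬝ᵥ x) ≤ (M *ᵥ x - t • x) ⬝ᵥ (M *ᵥ x - t • x) := by
  obtain ⟨v, hv⟩ := exists_isSortedEigenbasis hM
  rw [hv.dotProduct_eq x x, hv.dotProduct_eq (M *ᵥ x - t • x), Finset.mul_sum]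
  refine Finset.sum_le_sum fun i _ => ?_
  rw [dotProduct_sub, hv.dotProduct_mulVec hM, dotProduct_smul, smul_eq_mul]
  by_cases hi : eigval M (i.1 + 1) < eigval M (r + 1)
  · simp [hv.dotProduct_eq_zero hM hu hue hx i hi]
  · have h : (eigval M (r + 1) - t) ^ 2 ≤ (eigval M (i.1 + 1) - t) ^ 2 := by
      apply pow_le_pow_left₀ <;> linarith
    nlinarith [mul_self_nonneg (v i ⬝ᵥ x)]

/-- Min-max: by dimension count an `(r+1)`-dimensional test space contains a nonzero vector
orthogonal to the first `r` eigenvectors. -/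
theorem eigval_le_of_forall_le {M : Matrix V V ℝ} (hM : M.IsHermitian) {r : ℕ}
    (hr : r + 1 ≤ Fintype.card V) (f : (Fin (r + 1) → ℝ) →ₗ[ℝ] (V → ℝ))
    (hf : Function.Injective f) {t : ℝ} (ht : ∀ a, f a ⬝ᵥ M *ᵥ f a ≤ t * (f a ⬝ᵥ f a)) :
    eigval M (r + 1) ≤ t := by
  obtain ⟨v, hv⟩ := exists_isSortedEigenbasis hM
  let u : Fin r → V → ℝ := fun i => v ⟨i.1, by omega⟩
  let g : (Fin (r + 1) → ℝ) →ₗ[ℝ] (Fin r → ℝ) :=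
    { toFun := fun a i => u i ⬝ᵥ f a
      map_add' := fun a b => by ext i; simp
      map_smul' := fun a b => by ext i; simp }
  obtain ⟨a, ha, ha0⟩ := (Submodule.ne_bot_iff _).1
    (LinearMap.ker_ne_bot_of_finrank_lt (f := g) (by simp))
  have hx : ∀ i, u i ⬝ᵥ f a = 0 := fun i => congrFun (LinearMap.mem_ker.1 ha) i
  have h1 := eigval_mul_dotProduct_self_le hM (u := u)
    (fun i j => by simp [u, hv.orthonormal, Fin.ext_iff]) (fun i => hv.eigen _) hx
  have hpos : 0 < f a ⬝ᵥ f a := by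
    have : f a ≠ 0 := fun h => ha0 (hf (by simpa using h))
    exact lt_of_le_of_ne (Finset.sum_nonneg fun i _ => mul_self_nonneg _)
      (Ne.symm (by simpa [dotProduct_self_eq_zero] using this))
  exact le_of_mul_le_mul_right (h1.trans (ht a)) hpos

end SpectralCoordinates

/-! ### Graph Laplacians: quadratic form, constants, residuals. -/

section Laplacian

variable {V : Type*} [Fintype V] [DecidableEq V] (G : SimpleGraph V)

theorem isHermitian_laplacian : (laplacian G).IsHermitian := by
  classical
  exact G.isHermitian_lapMatrix (R := ℝ)

theorem transpose_laplacian : (laplacian G)ᵀ = laplacian G := by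
  rw [← Matrix.conjTranspose_eq_transpose_of_trivial]
  exact isHermitian_laplacian G

theorem laplacian_mulVec_one : laplacian G *ᵥ (fun _ => 1) = 0 := by
  classical
  exact G.lapMatrix_mulVec_const_eq_zero (R := ℝ)

open Classical in
theorem dotProduct_laplacian_mulVec (x : V → ℝ) :
    x ⬝ᵥ laplacian G *ᵥ x =
      (∑ i : V, ∑ j : V, if G.Adj i j then (x i - x j) ^ 2 else 0) / 2 := by
  have := G.lapMatrix_toLinearMap₂' (R := ℝ) x
  rw [Matrix.toLinearMap₂'_apply'] at this
  rw [← this]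
  unfold laplacian
  congr!

theorem dotProduct_laplacian_mulVec_nonneg (x : V → ℝ) : 0 ≤ x ⬝ᵥ laplacian G *ᵥ x := by
  classical
  rw [dotProduct_laplacian_mulVec]
  positivity

theorem dotProduct_laplacian_mulVec_le (x : V → ℝ) :
    x ⬝ᵥ laplacian G *ᵥ x ≤ 2 * Fintype.card V * (x ⬝ᵥ x) := by
  classical
  rw [dotProduct_laplacian_mulVec]
  have h : ∀ i j : V, (if G.Adj i j then (x i - x j) ^ 2 else 0) ≤ 2 * x i ^ 2 + 2 * x j ^ 2 := by
    intro i j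
    split_ifs
    · nlinarith [sq_nonneg (x i + x j)]
    · positivity
  have h2 := Finset.sum_le_sum fun i (_ : i ∈ Finset.univ) =>
    Finset.sum_le_sum fun j (_ : j ∈ Finset.univ) => h i j
  have h3 : ∑ i : V, ∑ j : V, (2 * x i ^ 2 + 2 * x j ^ 2) = 4 * Fintype.card V * (x ⬝ᵥ x) := by
    simp_rw [Finset.sum_add_distrib, ← Finset.mul_sum, dotProduct, ← sq]
    simp [← Finset.mul_sum]
    ring
  linarith

theorem laplacian_mulVec_dotProduct (x y : V → ℝ) :
    (laplacian G *ᵥ x) ⬝ᵥ y = x ⬝ᵥ laplacian G *ᵥ y := by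
  rw [Matrix.dotProduct_mulVec, ← Matrix.mulVec_transpose, transpose_laplacian]

theorem eigval_laplacian_one [Nonempty V] : eigval (laplacian G) 1 = 0 := by
  have hM := isHermitian_laplacian G
  have hc : 0 + 1 ≤ Fintype.card V := Fintype.card_pos
  apply le_antisymm
  · have h := eigval_mul_dotProduct_self_le hM (u := Fin.elim0) (fun i => i.elim0)
      (fun i => i.elim0) (x := fun _ => 1) (fun i => i.elim0)
    rw [laplacian_mulVec_one, dotProduct_zero] at h
    have h2 : (0 : ℝ) < Fintype.card V := by exact_mod_cast hc
    simp [dotProduct] at h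
    nlinarith
  · obtain ⟨v, hv⟩ := exists_isSortedEigenbasis hM
    have h := dotProduct_laplacian_mulVec_nonneg G (v ⟨0, hc⟩)
    rw [hv.eigen, dotProduct_smul, hv.orthonormal] at h
    simpa using h

/-- The normalized all-ones vector followed by the columns of `Y`. -/
noncomputable def consOne {r : ℕ} (Y : Matrix V (Fin r) ℝ) : Fin (r + 1) → V → ℝ :=
  Fin.cons (fun _ => (√(Fintype.card V))⁻¹) fun j i => Y i j

/-- Prepending the eigenvector of `λ_1 = 0` turns an embedding into eigenvectors for the `r + 1`
smallest eigenvalues, the input of the variational lemmas. -/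
theorem consOne_spec [Nonempty V] {r : ℕ} {Y : Matrix V (Fin r) ℝ} (ho : Yᵀ * Y = 1)
    (hc : Yᵀ *ᵥ (fun _ => 1) = 0)
    (he : laplacian G * Y = Y * Matrix.diagonal fun j : Fin r => eigval (laplacian G) (j.1 + 2)) :
    (∀ i j, consOne Y i ⬝ᵥ consOne Y j = if i = j then 1 else 0) ∧
      ∀ i, laplacian G *ᵥ consOne Y i = eigval (laplacian G) (i.1 + 1) • consOne Y i := by
  have hn : (0 : ℝ) < Fintype.card V := by exact_mod_cast Fintype.card_pos
  have hsum : ∀ j, ∑ i, Y i j = 0 := by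
    intro j
    have := congrFun hc j
    simpa [Matrix.mulVec, dotProduct] using this
  have hone : (fun _ : V => (√(Fintype.card V : ℝ))⁻¹) = (√(Fintype.card V : ℝ))⁻¹ • fun _ => 1 := by
    ext; simp
  constructor
  · intro i j
    refine Fin.cases ?_ (fun i => ?_) i <;> refine Fin.cases ?_ (fun j => ?_) j
    · simp only [consOne, Fin.cons_zero, dotProduct, Finset.sum_const, Finset.card_univ,
        nsmul_eq_mul, if_true]
      rw [← mul_inv, Real.mul_self_sqrt hn.le, mul_inv_cancel₀ hn.ne']
    · simp [consOne, dotProduct, ← Finset.mul_sum, hsum, (Fin.succ_ne_zero _).symm]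
    · simp [consOne, dotProduct, ← Finset.sum_mul, hsum, Fin.succ_ne_zero]
    · have := congrFun (congrFun ho i) j
      simpa [consOne, dotProduct, Matrix.mul_apply, Matrix.one_apply] using this
  · intro i
    refine Fin.cases ?_ (fun i => ?_) i
    · simp only [consOne, Fin.cons_zero, Fin.val_zero, zero_add, eigval_laplacian_one, zero_smul]
      rw [hone, Matrix.mulVec_smul, laplacian_mulVec_one, smul_zero]
    · ext k
      have := congrFun (congrFun he k) i
      rw [Matrix.mul_diagonal] at this
      simp only [consOne, Fin.cons_succ, Pi.smul_apply, smul_eq_mul, Fin.val_succ]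
      rw [mul_comm, show i.1 + 1 + 1 = i.1 + 2 from rfl, ← this]
      rfl

/-- On the complement of the constants, the Laplacian is at least `λ₂`. -/
theorem eigval_two_mul_le (hV : 2 ≤ Fintype.card V) {x : V → ℝ} (hx : ∑ i, x i = 0) :
    eigval (laplacian G) 2 * (x ⬝ᵥ x) ≤ x ⬝ᵥ laplacian G *ᵥ x := by
  have : Nonempty V := Fintype.card_pos_iff.1 (by omega)
  obtain ⟨h1, h2⟩ := consOne_spec G (Y := (0 : Matrix V (Fin 0) ℝ))
    (Subsingleton.elim _ _) (Subsingleton.elim _ _) (by ext i j; exact j.elim0)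
  refine eigval_mul_dotProduct_self_le (isHermitian_laplacian G) h1 h2 fun i => ?_
  obtain rfl : i = 0 := Fin.ext (by omega)
  simp [consOne, dotProduct, ← Finset.mul_sum, hx]

theorem eigval_two_nonneg (hV : 2 ≤ Fintype.card V) : 0 ≤ eigval (laplacian G) 2 := by
  have : Nonempty V := Fintype.card_pos_iff.1 (by omega)
  rw [← eigval_laplacian_one G]
  exact eigval_mono (isHermitian_laplacian G) le_rfl (by norm_num) hV

theorem sum_laplacian_mulVec (x : V → ℝ) : ∑ i, (laplacian G *ᵥ x) i = 0 := by
  have h := laplacian_mulVec_dotProduct G x (fun _ => 1)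
  rw [laplacian_mulVec_one, dotProduct_zero] at h
  simpa [dotProduct] using h

/-- On centred vectors `A = L - λ_2` has spectrum in `[0, 2n]`, hence `A² ≤ 2n A`. A nearly minimal
Rayleigh quotient thus yields a small residual. -/
theorem dotProduct_self_laplacian_sub_le (hV : 2 ≤ Fintype.card V) {x : V → ℝ}
    (hx : ∑ i, x i = 0) :
    (laplacian G *ᵥ x - eigval (laplacian G) 2 • x) ⬝ᵥ
        (laplacian G *ᵥ x - eigval (laplacian G) 2 • x) ≤
      2 * Fintype.card V * (x ⬝ᵥ laplacian G *ᵥ x - eigval (laplacian G) 2 * (x ⬝ᵥ x)) := by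
  set τ := eigval (laplacian G) 2
  set y := laplacian G *ᵥ x - τ • x with hy
  have hτ : 0 ≤ τ := eigval_two_nonneg G hV
  have hn : (2 : ℝ) ≤ Fintype.card V := by exact_mod_cast hV
  set s : ℝ := (2 * Fintype.card V : ℝ)⁻¹ with hs
  have hs0 : 0 < s := by positivity
  have hys : ∑ i, y i = 0 := by
    simp [hy, Finset.sum_sub_distrib, sum_laplacian_mulVec, ← Finset.mul_sum, hx]
  -- A gradient step of length `s = 1 / (2n)`: nonnegativity of the form of `A` at `x - s y` gives
  -- `s ‖y‖² ≤ xᵀ A x`, since `s yᵀ L y ≤ ‖y‖²`.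
  have h := eigval_two_mul_le G hV (x := x - s • y)
    (by simp [Finset.sum_sub_distrib, ← Finset.mul_sum, hx, hys])
  have hle := dotProduct_laplacian_mulVec_le G y
  have e1 : x ⬝ᵥ laplacian G *ᵥ y = y ⬝ᵥ laplacian G *ᵥ x := by
    rw [← laplacian_mulVec_dotProduct, dotProduct_comm]
  have e2 : y ⬝ᵥ laplacian G *ᵥ x = y ⬝ᵥ y + τ * (x ⬝ᵥ y) := by
    have : laplacian G *ᵥ x = y + τ • x := by simp [hy]
    rw [this, dotProduct_add, dotProduct_smul, smul_eq_mul, dotProduct_comm x y]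
  simp only [Matrix.mulVec_sub, Matrix.mulVec_smul, sub_dotProduct, dotProduct_sub, smul_dotProduct,
    dotProduct_smul, smul_eq_mul, e1, e2, dotProduct_comm y x] at h
  have hyy : 0 ≤ y ⬝ᵥ y := Finset.sum_nonneg fun i _ => mul_self_nonneg _
  have hsn : s * (2 * Fintype.card V) = 1 := by
    rw [hs]; field_simp
  have h5 : s * (y ⬝ᵥ laplacian G *ᵥ y) ≤ y ⬝ᵥ y := by
    calc _ ≤ s * (2 * Fintype.card V * (y ⬝ᵥ y)) := by gcongr
      _ = y ⬝ᵥ y := by rw [← mul_assoc, hsn, one_mul]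
  have h6 : s * (s * (y ⬝ᵥ laplacian G *ᵥ y)) ≤ s * (y ⬝ᵥ y) := by gcongr
  have h7 : 0 ≤ s * s * τ * (y ⬝ᵥ y) := by positivity
  have h8 : s * (y ⬝ᵥ y) ≤ x ⬝ᵥ laplacian G *ᵥ x - τ * (x ⬝ᵥ x) := by
    linarith
  calc y ⬝ᵥ y = 2 * Fintype.card V * (s * (y ⬝ᵥ y)) := by
        rw [← mul_assoc, mul_comm _ s, hsn, one_mul]
    _ ≤ _ := by gcongr

end Laplacian

/-! ### Frobenius norm and orthogonal projections. -/

section Frobenius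

variable {m n : Type*} [Fintype m] [Fintype n]

theorem frobNorm_nonneg (M : Matrix m n ℝ) : 0 ≤ frobNorm M := Real.sqrt_nonneg _

theorem frobNorm_sq (M : Matrix m n ℝ) : frobNorm M ^ 2 = ∑ i, ∑ j, M i j ^ 2 :=
  Real.sq_sqrt (by positivity)

theorem frobNorm_sq_eq_sum_col (M : Matrix m n ℝ) :
    frobNorm M ^ 2 = ∑ j, (fun i => M i j) ⬝ᵥ (fun i => M i j) := by
  rw [frobNorm_sq, Finset.sum_comm]
  simp [dotProduct, sq]

theorem frobNorm_eq_norm (M : Matrix m n ℝ) :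
    frobNorm M = ‖(WithLp.toLp 2 fun p : m × n => M p.1 p.2 : EuclideanSpace ℝ (m × n))‖ := by
  rw [EuclideanSpace.norm_eq, frobNorm, Fintype.sum_prod_type]
  simp

theorem frobNorm_add_le (A B : Matrix m n ℝ) : frobNorm (A + B) ≤ frobNorm A + frobNorm B := by
  rw [frobNorm_eq_norm, frobNorm_eq_norm A, frobNorm_eq_norm B]
  exact norm_add_le (WithLp.toLp 2 fun p : m × n => A p.1 p.2 : EuclideanSpace ℝ (m × n))
    (WithLp.toLp 2 fun p : m × n => B p.1 p.2)

variable {r : ℕ} {Y : Matrix m (Fin r) ℝ}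

theorem mulVec_transpose_dotProduct_self_le (ho : Yᵀ * Y = 1) (x : m → ℝ) :
    (Yᵀ *ᵥ x) ⬝ᵥ (Yᵀ *ᵥ x) ≤ x ⬝ᵥ x := by
  have h1 : x ⬝ᵥ (Y *ᵥ (Yᵀ *ᵥ x)) = (Yᵀ *ᵥ x) ⬝ᵥ (Yᵀ *ᵥ x) := by
    rw [Matrix.dotProduct_mulVec, ← Matrix.mulVec_transpose]
  have h2 : (Y *ᵥ (Yᵀ *ᵥ x)) ⬝ᵥ (Y *ᵥ (Yᵀ *ᵥ x)) = (Yᵀ *ᵥ x) ⬝ᵥ (Yᵀ *ᵥ x) := by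
    rw [Matrix.dotProduct_mulVec, ← Matrix.mulVec_transpose, Matrix.mulVec_mulVec, ho,
      Matrix.one_mulVec]
  have h3 : 0 ≤ (x - Y *ᵥ (Yᵀ *ᵥ x)) ⬝ᵥ (x - Y *ᵥ (Yᵀ *ᵥ x)) :=
    Finset.sum_nonneg fun i _ => mul_self_nonneg _
  simp only [sub_dotProduct, dotProduct_sub] at h3
  rw [dotProduct_comm (Y *ᵥ (Yᵀ *ᵥ x)) x, h1, h2] at h3
  linarith

theorem frobNorm_mul_le (ho : Yᵀ * Y = 1) {l : Type*} [Fintype l] (A : Matrix l m ℝ) :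
    frobNorm (A * Y) ≤ frobNorm A := by
  refine Real.sqrt_le_sqrt (Finset.sum_le_sum fun i _ => ?_)
  have h := mulVec_transpose_dotProduct_self_le ho (A i)
  simpa [dotProduct, Matrix.mulVec, Matrix.mul_apply, sq, mul_comm] using h

theorem frobNorm_sq_of_orthonormal (ho : Yᵀ * Y = 1) : frobNorm Y ^ 2 = r := by
  rw [frobNorm_sq_eq_sum_col]
  have : ∀ j, (fun i => Y i j) ⬝ᵥ (fun i => Y i j) = 1 := by
    intro j
    have := congrFun (congrFun ho j) j
    simpa [dotProduct, Matrix.mul_apply] using this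
  simp [this]

variable [DecidableEq m]

/-- Pythagoras, column by column. -/
theorem frobNorm_compl_sq (ho : Yᵀ * Y = 1) {l : Type*} [Fintype l] (B : Matrix m l ℝ) :
    frobNorm ((1 - Y * Yᵀ) * B) ^ 2 = frobNorm B ^ 2 - frobNorm (Yᵀ * B) ^ 2 := by
  simp only [frobNorm_sq_eq_sum_col, ← Finset.sum_sub_distrib]
  refine Finset.sum_congr rfl fun j _ => ?_
  set x : m → ℝ := fun i => B i j with hx
  have e1 : (fun i => ((1 - Y * Yᵀ) * B : Matrix m l ℝ) i j) = x - Y *ᵥ (Yᵀ *ᵥ x) := by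
    have : (fun i => ((1 - Y * Yᵀ) * B : Matrix m l ℝ) i j) = (1 - Y * Yᵀ) *ᵥ x := rfl
    rw [this, Matrix.sub_mulVec, Matrix.one_mulVec, Matrix.mulVec_mulVec]
  have e2 : (fun i => (Yᵀ * B) i j) = Yᵀ *ᵥ x := rfl
  rw [e1, e2]
  have h1 : x ⬝ᵥ (Y *ᵥ (Yᵀ *ᵥ x)) = (Yᵀ *ᵥ x) ⬝ᵥ (Yᵀ *ᵥ x) := by
    rw [Matrix.dotProduct_mulVec, ← Matrix.mulVec_transpose]
  have h2 : (Y *ᵥ (Yᵀ *ᵥ x)) ⬝ᵥ (Y *ᵥ (Yᵀ *ᵥ x)) = (Yᵀ *ᵥ x) ⬝ᵥ (Yᵀ *ᵥ x) := by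
    rw [Matrix.dotProduct_mulVec, ← Matrix.mulVec_transpose, Matrix.mulVec_mulVec, ho,
      Matrix.one_mulVec]
  simp only [sub_dotProduct, dotProduct_sub]
  rw [dotProduct_comm (Y *ᵥ (Yᵀ *ᵥ x)) x, h1, h2]
  ring

theorem frobNorm_compl_le (ho : Yᵀ * Y = 1) {l : Type*} [Fintype l] (B : Matrix m l ℝ) :
    frobNorm ((1 - Y * Yᵀ) * B) ≤ frobNorm B := by
  refine le_of_sq_le_sq ?_ (frobNorm_nonneg _)
  rw [frobNorm_compl_sq ho]
  nlinarith [sq_nonneg (frobNorm (Yᵀ * B))]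

end Frobenius

/-! ### Principal angles. -/

section SinTheta

variable {V : Type*} [Fintype V] {r : ℕ} {Y Z : Matrix V (Fin r) ℝ}

theorem norm_toEuclideanLin_sq {r s : ℕ} (M : Matrix (Fin r) (Fin s) ℝ)
    (x : EuclideanSpace ℝ (Fin s)) :
    ‖Matrix.toEuclideanLin M x‖ ^ 2 = ∑ i, (M i ⬝ᵥ (x : Fin s → ℝ)) ^ 2 := by
  rw [EuclideanSpace.norm_sq_eq]
  simp [Matrix.toLpLin_apply, Matrix.mulVec]

theorem norm_sq_eigenvector_eq_singularValues_sq {r s : ℕ} (M : Matrix (Fin r) (Fin s) ℝ) :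
    ∃ b : OrthonormalBasis (Fin s) ℝ (EuclideanSpace ℝ (Fin s)), ∀ k,
      ‖Matrix.toEuclideanLin M (b k)‖ ^ 2 =
        (Matrix.toEuclideanLin M).singularValues k ^ 2 := by
  set T := Matrix.toEuclideanLin M
  have hn : Module.finrank ℝ (EuclideanSpace ℝ (Fin s)) = s := by simp
  refine ⟨T.isSymmetric_adjoint_comp_self.eigenvectorBasis hn, fun k => ?_⟩
  rw [T.sq_singularValues_fin hn]
  have h := T.isSymmetric_adjoint_comp_self.apply_eigenvectorBasis hn k
  set b := T.isSymmetric_adjoint_comp_self.eigenvectorBasis hn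
  rw [← real_inner_self_eq_norm_sq, ← LinearMap.adjoint_inner_right]
  rw [LinearMap.comp_apply] at h
  rw [h]
  simp [inner_smul_right]

theorem sum_singularValues_sq {r s : ℕ} (M : Matrix (Fin r) (Fin s) ℝ) :
    ∑ k : Fin s, (Matrix.toEuclideanLin M).singularValues k ^ 2 = frobNorm M ^ 2 := by
  obtain ⟨b, hb⟩ := norm_sq_eigenvector_eq_singularValues_sq M
  simp_rw [← hb, norm_toEuclideanLin_sq]
  rw [Finset.sum_comm, frobNorm_sq]
  refine Finset.sum_congr rfl fun i _ => ?_
  have h := b.sum_sq_norm_inner_left (WithLp.toLp 2 (M i))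
  rw [EuclideanSpace.norm_sq_eq] at h
  simpa [PiLp.inner_apply, dotProduct, mul_comm] using h

theorem singularValues_le_one (hY : Yᵀ * Y = 1) (hZ : Zᵀ * Z = 1) (k : Fin r) :
    (Matrix.toEuclideanLin (Yᵀ * Z)).singularValues k ≤ 1 := by
  obtain ⟨b, hb⟩ := norm_sq_eigenvector_eq_singularValues_sq (Yᵀ * Z)
  have h1 : ‖Matrix.toEuclideanLin (Yᵀ * Z) (b k)‖ ^ 2 ≤ ‖b k‖ ^ 2 := by
    have e : ∀ x : EuclideanSpace ℝ (Fin r), ‖x‖ ^ 2 = (x : Fin r → ℝ) ⬝ᵥ (x : Fin r → ℝ) := by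
      intro x
      rw [EuclideanSpace.norm_sq_eq]
      simp [dotProduct, sq]
    rw [e, e]
    set x : Fin r → ℝ := (b k : Fin r → ℝ)
    have : ((Matrix.toEuclideanLin (Yᵀ * Z) (b k) : EuclideanSpace ℝ (Fin r)) : Fin r → ℝ) =
        Yᵀ *ᵥ (Z *ᵥ x) := by
      rw [Matrix.toLpLin_apply, Matrix.mulVec_mulVec]
    rw [this]
    refine (mulVec_transpose_dotProduct_self_le hY _).trans_eq ?_
    rw [Matrix.dotProduct_mulVec, ← Matrix.mulVec_transpose, Matrix.mulVec_mulVec, hZ,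
      Matrix.one_mulVec]
  rw [hb, b.norm_eq_one, one_pow] at h1
  exact (sq_le_one_iff₀ (LinearMap.singularValues_nonneg _ _)).1 h1

/-- Both squares equal `r - ‖Yᵀ Z‖_F²`, because the squared singular values sum to the squared
Frobenius norm. This removes the singular values from the rest of the argument. -/
theorem sinThetaNorm_eq [DecidableEq V] (hY : Yᵀ * Y = 1) (hZ : Zᵀ * Z = 1) :
    sinThetaNorm Y Z = frobNorm ((1 - Y * Yᵀ) * Z) := by
  refine (pow_left_inj₀ (frobNorm_nonneg _) (frobNorm_nonneg _) two_ne_zero).1 ?_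
  rw [frobNorm_compl_sq hY, frobNorm_sq_of_orthonormal hZ, ← sum_singularValues_sq (Yᵀ * Z),
    frobNorm_sq]
  have h : ∀ i : Fin r, ∑ j, (principalAngles Y Z).map Real.sin i j ^ 2 =
      1 - (Matrix.toEuclideanLin (Yᵀ * Z)).singularValues i ^ 2 := by
    intro i
    rw [Finset.sum_eq_single i]
    · rw [Matrix.map_apply, principalAngles, Matrix.diagonal_apply_eq, Real.sin_arccos,
        Real.sq_sqrt]
      have h1 := singularValues_le_one hY hZ i
      have h2 := LinearMap.singularValues_nonneg (Matrix.toEuclideanLin (Yᵀ * Z)) i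
      nlinarith
    · intro j _ hj
      simp [principalAngles, Matrix.diagonal_apply_ne _ hj.symm]
    · simp
  rw [Finset.sum_congr rfl fun i _ => h i, Finset.sum_sub_distrib, Finset.sum_const,
    Finset.card_univ, Fintype.card_fin, nsmul_one]

end SinTheta

/-! ### Davis–Kahan bounds. -/

section DavisKahan

variable {V : Type*} [Fintype V] [DecidableEq V] {r : ℕ} {Y Z : Matrix V (Fin r) ℝ}
  {G G' : SimpleGraph V}

/-- The projection `Q = 1 - Y Yᵀ` commutes with `L`, so `(L - t) Q Z = Q (L Z - t Z)`. The columns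
of `Q Z` are orthogonal to `1` and to `Y`, where `L - t` is at least `λ_{r+2} - t`. -/
theorem sub_mul_sinThetaNorm_le (hV : r + 2 ≤ Fintype.card V)
    (hY : IsSpectralEmbedding (K := r + 1) (laplacian G) Y) (hZ : Zᵀ * Z = 1)
    (hZ1 : Zᵀ *ᵥ (fun _ => 1) = 0) {t : ℝ} (ht : t ≤ eigval (laplacian G) (r + 2)) :
    (eigval (laplacian G) (r + 2) - t) * sinThetaNorm Y Z ≤
      frobNorm (laplacian G * Z - t • Z) := by
  have : Nonempty V := Fintype.card_pos_iff.1 (by omega)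
  have ho : Yᵀ * Y = 1 := hY.orthonormal
  have he := hY.eigen
  have hc := hY.centered
  obtain ⟨hu, hue⟩ := consOne_spec G ho hc he
  set L := laplacian G with hL
  rw [sinThetaNorm_eq ho hZ]
  set Q : Matrix V V ℝ := 1 - Y * Yᵀ with hQ
  have hLT : Lᵀ = L := transpose_laplacian G
  have hcomm : L * Q = Q * L := by
    have h1 : L * (Y * Yᵀ) = Y * Yᵀ * L := by
      rw [← Matrix.mul_assoc]
      have h2 : Yᵀ * L = Matrix.diagonal (fun j : Fin r => eigval L (j.1 + 2)) * Yᵀ := by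
        have := congrArg Matrix.transpose he
        rw [Matrix.transpose_mul, Matrix.transpose_mul, Matrix.diagonal_transpose, hLT] at this
        exact this
      rw [Matrix.mul_assoc Y, h2, ← Matrix.mul_assoc]
      exact congrArg (· * Yᵀ) he
    rw [hQ, Matrix.mul_sub, Matrix.sub_mul, h1, Matrix.mul_one, Matrix.one_mul]
  have hYQ : Yᵀ * Q = 0 := by
    rw [hQ, Matrix.mul_sub, ← Matrix.mul_assoc, ho, Matrix.one_mul, Matrix.mul_one, sub_self]
  refine le_trans ?_ (frobNorm_compl_le ho _)
  refine le_of_sq_le_sq ?_ (frobNorm_nonneg _)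
  rw [mul_pow, frobNorm_sq_eq_sum_col, frobNorm_sq_eq_sum_col, Finset.mul_sum]
  refine Finset.sum_le_sum fun j _ => ?_
  set x : V → ℝ := fun i => (Q * Z) i j with hx
  have hperp : ∀ i, consOne Y i ⬝ᵥ x = 0 := by
    intro i
    refine Fin.cases ?_ (fun i => ?_) i
    · have h1 : (fun _ => (1 : ℝ)) ⬝ᵥ x = 0 := by
        have h2 : (fun _ : V => (1 : ℝ)) ᵥ* (Q * Z) = 0 := by
          rw [← Matrix.vecMul_vecMul, hQ, Matrix.vecMul_sub, Matrix.vecMul_one,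
            ← Matrix.vecMul_vecMul, ← Matrix.mulVec_transpose Y, hc, Matrix.zero_vecMul, sub_zero,
            ← Matrix.mulVec_transpose, hZ1]
        exact congrFun h2 j
      have h3 : consOne Y 0 = (√(Fintype.card V : ℝ))⁻¹ • fun _ => (1 : ℝ) := by
        ext; simp [consOne]
      rw [h3, smul_dotProduct, h1, smul_zero]
    · have h2 : Yᵀ * (Q * Z) = 0 := by rw [← Matrix.mul_assoc, hYQ, Matrix.zero_mul]
      exact congrFun (congrFun h2 i) j
  have h := sq_mul_dotProduct_self_le (isHermitian_laplacian G) hu hue hperp (t := t) ht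
  have e : (fun i => (Q * (L * Z - t • Z)) i j) = L *ᵥ x - t • x := by
    have : Q * (L * Z - t • Z) = L * (Q * Z) - t • (Q * Z) := by
      rw [Matrix.mul_sub, ← Matrix.mul_assoc, ← hcomm, Matrix.mul_assoc, Matrix.mul_smul]
    rw [this]
    rfl
  rw [e]
  exact h

/-- The case of the opposite order of eigenvalues: each column of `Y` has Rayleigh quotient at most
`λ_{r+2}(L)` for `L` and at least `λ_2(L')` for `L'`, so `L - L'` moves each of the `r` columns by
at least the difference. -/
theorem sub_mul_sqrt_le (hV : r + 2 ≤ Fintype.card V)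
    (hY : IsSpectralEmbedding (K := r + 1) (laplacian G) Y)
    (ht : eigval (laplacian G) (r + 2) ≤ eigval (laplacian G') 2) :
    (eigval (laplacian G') 2 - eigval (laplacian G) (r + 2)) * √r ≤
      frobNorm (laplacian G - laplacian G') := by
  have ho : Yᵀ * Y = 1 := hY.orthonormal
  have he := hY.eigen
  have hc := hY.centered
  set L := laplacian G with hL
  set L' := laplacian G' with hL'
  refine le_trans ?_ (frobNorm_mul_le ho _)
  refine le_of_sq_le_sq ?_ (frobNorm_nonneg _)
  rw [mul_pow, Real.sq_sqrt (Nat.cast_nonneg _), frobNorm_sq_eq_sum_col]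
  have h : ∀ j : Fin r, (eigval L' 2 - eigval L (r + 2)) ^ 2 ≤
      (fun i => ((L - L') * Y) i j) ⬝ᵥ fun i => ((L - L') * Y) i j := by
    intro j
    set y : V → ℝ := fun i => Y i j with hy
    have e : (fun i => ((L - L') * Y) i j) = L *ᵥ y - L' *ᵥ y := by
      rw [← Matrix.sub_mulVec]; rfl
    have hyy : y ⬝ᵥ y = 1 := by
      have := congrFun (congrFun ho j) j
      simpa [dotProduct, Matrix.mul_apply] using this
    have hys : ∑ i, y i = 0 := by
      have := congrFun hc j
      simpa [Matrix.mulVec, dotProduct] using this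
    have h1 : L *ᵥ y = eigval L (j.1 + 2) • y := by
      ext k
      have := congrFun (congrFun he k) j
      rw [Matrix.mul_diagonal] at this
      rw [Pi.smul_apply, smul_eq_mul, mul_comm, ← this]
      rfl
    have h2 : eigval L (j.1 + 2) ≤ eigval L (r + 2) :=
      eigval_mono (isHermitian_laplacian G) (by omega) (by omega) hV
    have h3 := eigval_two_mul_le G' (by omega) hys
    rw [e]
    set d := L *ᵥ y - L' *ᵥ y with hd
    have h4 : y ⬝ᵥ d = eigval L (j.1 + 2) - y ⬝ᵥ L' *ᵥ y := by
      rw [hd, dotProduct_sub, h1, dotProduct_smul, hyy, smul_eq_mul, mul_one]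
    -- Cauchy–Schwarz for the unit vector `y`: `(y ⬝ᵥ d)² ≤ d ⬝ᵥ d`.
    have h5 : 0 ≤ (d - (y ⬝ᵥ d) • y) ⬝ᵥ (d - (y ⬝ᵥ d) • y) :=
      Finset.sum_nonneg fun i _ => mul_self_nonneg _
    simp only [sub_dotProduct, dotProduct_sub, smul_dotProduct, dotProduct_smul, smul_eq_mul,
      dotProduct_comm d y, hyy] at h5
    rw [hyy, mul_one] at h3
    nlinarith
  calc _ = ∑ _j : Fin r, (eigval L' 2 - eigval L (r + 2)) ^ 2 := by simp [mul_comm]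
    _ ≤ _ := Finset.sum_le_sum fun j _ => h j

theorem sinThetaNorm_le_sqrt (hY : Yᵀ * Y = 1) (hZ : Zᵀ * Z = 1) : sinThetaNorm Y Z ≤ √r := by
  rw [sinThetaNorm_eq hY hZ, ← frobNorm_sq_of_orthonormal hZ, Real.sqrt_sq (frobNorm_nonneg _)]
  exact frobNorm_compl_le hY _

/-- A Davis–Kahan bound in which `Z` only has to consist of approximate eigenvectors of the second
Laplacian. -/
theorem abs_sub_mul_sinThetaNorm_le (hV : r + 2 ≤ Fintype.card V)
    (hY : IsSpectralEmbedding (K := r + 1) (laplacian G) Y) (hZ : Zᵀ * Z = 1)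
    (hZ1 : Zᵀ *ᵥ (fun _ => 1) = 0) :
    |eigval (laplacian G) (r + 2) - eigval (laplacian G') 2| * sinThetaNorm Y Z ≤
      frobNorm (laplacian G - laplacian G') +
        √(2 * Fintype.card V * ∑ j, ((fun i => Z i j) ⬝ᵥ laplacian G' *ᵥ (fun i => Z i j)
          - eigval (laplacian G') 2)) := by
  rcases le_total (eigval (laplacian G') 2) (eigval (laplacian G) (r + 2)) with h | h
  · rw [abs_of_nonneg (sub_nonneg.2 h)]
    refine (sub_mul_sinThetaNorm_le hV hY hZ hZ1 h).trans ?_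
    have e : laplacian G * Z - eigval (laplacian G') 2 • Z = (laplacian G - laplacian G') * Z +
        (laplacian G' * Z - eigval (laplacian G') 2 • Z) := by
      rw [Matrix.sub_mul]; abel
    rw [e]
    refine (frobNorm_add_le _ _).trans (add_le_add (frobNorm_mul_le hZ _) ?_)
    refine Real.le_sqrt_of_sq_le ?_
    rw [frobNorm_sq_eq_sum_col, Finset.mul_sum]
    refine Finset.sum_le_sum fun j _ => ?_
    have hzz : (fun i => Z i j) ⬝ᵥ (fun i => Z i j) = 1 := by
      have := congrFun (congrFun hZ j) j
      simpa [dotProduct, Matrix.mul_apply] using this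
    have hzs : ∑ i, Z i j = 0 := by
      have := congrFun hZ1 j
      simpa [Matrix.mulVec, dotProduct] using this
    have := dotProduct_self_laplacian_sub_le G' (by omega) hzs
    rw [hzz, mul_one] at this
    exact this
  · rw [abs_sub_comm, abs_of_nonneg (sub_nonneg.2 h)]
    calc _ ≤ (eigval (laplacian G') 2 - eigval (laplacian G) (r + 2)) * √r :=
          mul_le_mul_of_nonneg_left (sinThetaNorm_le_sqrt hY.orthonormal hZ) (sub_nonneg.2 h)
      _ ≤ _ := (sub_mul_sqrt_le hV hY h).trans (le_add_of_nonneg_right (Real.sqrt_nonneg _))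

end DavisKahan

/-! ### From cut norm to operator norm. -/

section CutNorm

variable {V : Type*} [Fintype V]

/-- Split the index set by the sign of `g`; each half costs `B`. -/
theorem abs_sum_mul_le_of_forall_subset {g b : V → ℝ} {B : ℝ}
    (hg : ∀ S : Finset V, |∑ i ∈ S, g i| ≤ B) (hb : ∀ i, |b i| ≤ 1) :
    |∑ i, b i * g i| ≤ 2 * B := by
  classical
  have h1 : |∑ i, b i * g i| ≤ ∑ i, |g i| := by
    refine (Finset.abs_sum_le_sum_abs _ _).trans (Finset.sum_le_sum fun i _ => ?_)
    rw [abs_mul]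
    exact mul_le_of_le_one_left (abs_nonneg _) (hb i)
  have h2 : ∑ i, |g i| = ∑ i ∈ Finset.univ.filter (fun i => 0 ≤ g i), g i -
      ∑ i ∈ Finset.univ.filter (fun i => ¬ 0 ≤ g i), g i := by
    rw [← Finset.sum_filter_add_sum_filter_not Finset.univ (fun i => 0 ≤ g i), sub_eq_add_neg,
      ← Finset.sum_neg_distrib]
    congr 1
    · exact Finset.sum_congr rfl fun i hi => abs_of_nonneg (Finset.mem_filter.1 hi).2
    · exact Finset.sum_congr rfl fun i hi =>
        abs_of_neg (not_le.1 (Finset.mem_filter.1 hi).2)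
  have h3 := abs_le.1 (hg (Finset.univ.filter (fun i => 0 ≤ g i)))
  have h4 := abs_le.1 (hg (Finset.univ.filter (fun i => ¬ 0 ≤ g i)))
  linarith [h3.2, h4.1]

theorem abs_sum_sum_mul_mul_le {W : Matrix V V ℝ} {B : ℝ}
    (hW : ∀ S T : Finset V, |∑ i ∈ S, ∑ j ∈ T, W i j| ≤ B) {a b : V → ℝ} (ha : ∀ i, |a i| ≤ 1)
    (hb : ∀ i, |b i| ≤ 1) : |∑ i, a i * ∑ j, b j * W i j| ≤ 4 * B := by
  have h : ∀ S : Finset V, |∑ i ∈ S, ∑ j, b j * W i j| ≤ 2 * B := by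
    intro S
    rw [Finset.sum_comm]
    simp_rw [← Finset.mul_sum]
    refine abs_sum_mul_le_of_forall_subset (fun T => ?_) hb
    rw [Finset.sum_comm]
    exact hW S T
  have := abs_sum_mul_le_of_forall_subset h ha
  linarith

theorem mulVec_dotProduct_self_le (M : Matrix V V ℝ) (x : V → ℝ) :
    (M *ᵥ x) ⬝ᵥ (M *ᵥ x) ≤ frobNorm M ^ 2 * (x ⬝ᵥ x) := by
  rw [frobNorm_sq, Finset.sum_mul]
  refine Finset.sum_le_sum fun _ _ => ?_
  rw [← sq, show x ⬝ᵥ x = ∑ j, x j ^ 2 by simp [dotProduct, sq]]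
  exact Finset.sum_mul_sq_le_sq_mul_sq _ _ _

theorem dotProduct_sq_le (x y : V → ℝ) : (x ⬝ᵥ y) ^ 2 ≤ (x ⬝ᵥ x) * (y ⬝ᵥ y) := by
  have := Finset.sum_mul_sq_le_sq_mul_sq Finset.univ x y
  simpa [dotProduct, sq] using this

theorem dotProduct_self_nonneg_real (x : V → ℝ) : 0 ≤ x ⬝ᵥ x :=
  Finset.sum_nonneg fun _ _ => mul_self_nonneg _

/-- `‖W²‖_F²` is a sum over closed walks of length four. With two opposite vertices `j`, `k` of the
expansion below fixed, the rest is a bilinear form in `W` with coefficients bounded by 1, controlled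
by the cut norm. -/
theorem frobNorm_mul_self_sq_le {W : Matrix V V ℝ} (h1 : ∀ i j, |W i j| ≤ 1)
    {B : ℝ} (hW : ∀ S T : Finset V, |∑ i ∈ S, ∑ j ∈ T, W i j| ≤ B) :
    frobNorm (W * W) ^ 2 ≤ (Fintype.card V : ℝ) ^ 2 * (4 * B) := by
  have e : frobNorm (W * W) ^ 2 =
      ∑ j, ∑ k, ∑ i, W i j * ∑ l, (W l k * W j k) * W i l := by
    rw [frobNorm_sq]
    simp_rw [Matrix.mul_apply, sq, Finset.sum_mul_sum, Finset.mul_sum]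
    calc _ = ∑ i, ∑ j, ∑ k, ∑ l, W i j * W j k * (W i l * W l k) :=
          Finset.sum_congr rfl fun i _ => Finset.sum_comm
      _ = ∑ j, ∑ i, ∑ k, ∑ l, W i j * W j k * (W i l * W l k) := Finset.sum_comm
      _ = ∑ j, ∑ k, ∑ i, ∑ l, W i j * W j k * (W i l * W l k) :=
          Finset.sum_congr rfl fun j _ => Finset.sum_comm
      _ = _ := by
          refine Finset.sum_congr rfl fun j _ => Finset.sum_congr rfl fun k _ =>
            Finset.sum_congr rfl fun i _ => Finset.sum_congr rfl fun l _ => ?_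
          ring
  rw [e]
  calc _ ≤ ∑ _j : V, ∑ _k : V, 4 * B := by
        refine Finset.sum_le_sum fun j _ => Finset.sum_le_sum fun k _ => ?_
        refine (le_abs_self _).trans (abs_sum_sum_mul_mul_le hW (fun i => h1 i j) fun l => ?_)
        rw [abs_mul]
        exact mul_le_one₀ (h1 _ _) (abs_nonneg _) (h1 _ _)
    _ = _ := by simp; ring

/-- A symmetric matrix with bounded entries and small cut norm has small operator norm. -/
theorem abs_dotProduct_mulVec_le {W : Matrix V V ℝ} (hs : Wᵀ = W) (h1 : ∀ i j, |W i j| ≤ 1)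
    {η : ℝ} (hη : 0 ≤ η)
    (hW : ∀ S T : Finset V, |∑ i ∈ S, ∑ j ∈ T, W i j| ≤ η ^ 4 / 4 * (Fintype.card V : ℝ) ^ 2)
    (x : V → ℝ) : |x ⬝ᵥ W *ᵥ x| ≤ η * Fintype.card V * (x ⬝ᵥ x) := by
  set n : ℝ := (Fintype.card V : ℝ)
  have hn : 0 ≤ n := Nat.cast_nonneg _
  have hF := frobNorm_mul_self_sq_le h1 hW
  have hx := dotProduct_self_nonneg_real x
  have e2 := dotProduct_sq_le x (W *ᵥ x)
  have e3 : (W *ᵥ x) ⬝ᵥ (W *ᵥ x) = x ⬝ᵥ ((W * W) *ᵥ x) := by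
    rw [← Matrix.mulVec_mulVec, Matrix.dotProduct_mulVec x, ← Matrix.mulVec_transpose, hs]
  have e4 := dotProduct_sq_le x ((W * W) *ᵥ x)
  have e5 := mulVec_dotProduct_self_le (W * W) x
  rw [← e3] at e4
  set A := (W *ᵥ x) ⬝ᵥ (W *ᵥ x)
  have hA : 0 ≤ A := dotProduct_self_nonneg_real _
  -- Cauchy–Schwarz is used twice, passing from `W` to `W²`; this is the source of the fourth power
  -- of `η` in the cut bound.
  have h6 : A ^ 2 ≤ (η ^ 2 * n ^ 2 * (x ⬝ᵥ x)) ^ 2 := by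
    calc A ^ 2 ≤ (x ⬝ᵥ x) * (frobNorm (W * W) ^ 2 * (x ⬝ᵥ x)) := e4.trans (by gcongr)
      _ ≤ (x ⬝ᵥ x) * ((n ^ 2 * (4 * (η ^ 4 / 4 * n ^ 2))) * (x ⬝ᵥ x)) := by gcongr
      _ = _ := by ring
  have h7 : A ≤ η ^ 2 * n ^ 2 * (x ⬝ᵥ x) := le_of_sq_le_sq h6 (by positivity)
  refine abs_le_of_sq_le_sq ?_ (by positivity)
  calc (x ⬝ᵥ W *ᵥ x) ^ 2 ≤ (x ⬝ᵥ x) * (η ^ 2 * n ^ 2 * (x ⬝ᵥ x)) := e2.trans (by gcongr)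
    _ = _ := by ring

theorem abs_sum_sum_mul_sub_sq_le {W : Matrix V V ℝ} (hs : Wᵀ = W) (h1 : ∀ i j, |W i j| ≤ 1)
    {η : ℝ} (hη : 0 ≤ η)
    (hW : ∀ S T : Finset V, |∑ i ∈ S, ∑ j ∈ T, W i j| ≤ η ^ 4 / 4 * (Fintype.card V : ℝ) ^ 2)
    (hd : ∀ i, |∑ j, W i j| ≤ η * Fintype.card V) (x : V → ℝ) :
    |(∑ i, ∑ j, W i j * (x i - x j) ^ 2) / 2| ≤ 2 * η * Fintype.card V * (x ⬝ᵥ x) := by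
  have hsym : ∀ i j, W i j = W j i := fun i j => congrFun (congrFun hs j) i
  have e : (∑ i, ∑ j, W i j * (x i - x j) ^ 2) / 2 =
      ∑ i, (∑ j, W i j) * (x i * x i) - x ⬝ᵥ W *ᵥ x := by
    have e1 : ∑ i, ∑ j, W i j * (x j * x j) = ∑ i, (∑ j, W i j) * (x i * x i) := by
      rw [Finset.sum_comm]
      refine Finset.sum_congr rfl fun i _ => ?_
      rw [Finset.sum_mul]
      exact Finset.sum_congr rfl fun j _ => by rw [hsym]
    have e2 : ∑ i, ∑ j, W i j * (x i * x i) = ∑ i, (∑ j, W i j) * (x i * x i) := by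
      simp_rw [Finset.sum_mul]
    have e3 : x ⬝ᵥ W *ᵥ x = ∑ i, ∑ j, W i j * (x i * x j) := by
      simp_rw [dotProduct, Matrix.mulVec, dotProduct, Finset.mul_sum]
      refine Finset.sum_congr rfl fun i _ => Finset.sum_congr rfl fun j _ => by ring
    have e4 : ∑ i, ∑ j, W i j * (x i - x j) ^ 2 = ∑ i, ∑ j, W i j * (x i * x i) +
        ∑ i, ∑ j, W i j * (x j * x j) - 2 * ∑ i, ∑ j, W i j * (x i * x j) := by
      simp_rw [Finset.mul_sum, ← Finset.sum_add_distrib, ← Finset.sum_sub_distrib]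
      refine Finset.sum_congr rfl fun i _ => Finset.sum_congr rfl fun j _ => by ring
    rw [e4, e1, e2, e3]
    ring
  rw [e]
  have h2 := abs_dotProduct_mulVec_le hs h1 hη hW x
  have h3 : |∑ i, (∑ j, W i j) * (x i * x i)| ≤ η * Fintype.card V * (x ⬝ᵥ x) := by
    refine (Finset.abs_sum_le_sum_abs _ _).trans ?_
    rw [dotProduct, Finset.mul_sum]
    refine Finset.sum_le_sum fun i _ => ?_
    rw [abs_mul, abs_of_nonneg (mul_self_nonneg (x i))]
    exact mul_le_mul_of_nonneg_right (hd i) (mul_self_nonneg _)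
  have := abs_sub (∑ i, (∑ j, W i j) * (x i * x i)) (x ⬝ᵥ W *ᵥ x)
  linarith

end CutNorm

/-! ### Mean and noise of the Laplacian form. -/

section Forms

variable {K : ℕ} {s : Fin K → ℕ}

open Classical in
/-- The quadratic form of the Laplacian of the disjoint union of the cluster graphs. -/
noncomputable def internalForm (H : ∀ k, SimpleGraph (Fin (s k))) (x : Nodes s → ℝ) : ℝ :=
  (∑ u, ∑ v, if ∃ (k : Fin K) (a b : Fin (s k)), u = ⟨k, a⟩ ∧ v = ⟨k, b⟩ ∧ (H k).Adj a b
    then (x u - x v) ^ 2 else 0) / 2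

/-- The quadratic form of the Laplacian of the complete multipartite graph. -/
noncomputable def multipartiteForm (x : Nodes s → ℝ) : ℝ :=
  (∑ u : Nodes s, ∑ v : Nodes s, if u.1 ≠ v.1 then (x u - x v) ^ 2 else 0) / 2

open Classical in
/-- The centred adjacency matrix between different clusters. -/
noncomputable def centeredAdj (p : ℝ) (G : SimpleGraph (Nodes s)) :
    Matrix (Nodes s) (Nodes s) ℝ :=
  fun u v => if u.1 ≠ v.1 then (if G.Adj u v then 1 else 0) - p else 0

theorem transpose_centeredAdj (p : ℝ) (G : SimpleGraph (Nodes s)) :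
    (centeredAdj p G)ᵀ = centeredAdj p G := by
  ext u v
  have h : v.1 ≠ u.1 ↔ u.1 ≠ v.1 := ne_comm
  simp only [Matrix.transpose_apply, centeredAdj, h]
  rw [G.adj_comm v u]

theorem abs_centeredAdj_le {p : ℝ} (hp : p ∈ Icc (0 : ℝ) 1) (G : SimpleGraph (Nodes s)) (u v) :
    |centeredAdj p G u v| ≤ 1 := by
  unfold centeredAdj
  rw [abs_le]
  split_ifs <;> constructor <;> linarith [hp.1, hp.2]

theorem dotProduct_laplacian_mulVec_eq {H : ∀ k, SimpleGraph (Fin (s k))}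
    {G : SimpleGraph (Nodes s)} (hG : ∀ k u v, G.Adj ⟨k, u⟩ ⟨k, v⟩ ↔ (H k).Adj u v) (p : ℝ)
    (x : Nodes s → ℝ) :
    x ⬝ᵥ laplacian G *ᵥ x = internalForm H x + p * multipartiteForm x +
      (∑ u, ∑ v, centeredAdj p G u v * (x u - x v) ^ 2) / 2 := by
  classical
  rw [dotProduct_laplacian_mulVec, internalForm, multipartiteForm, mul_div_assoc', ← add_div,
    ← add_div]
  congr 1
  simp_rw [Finset.mul_sum, ← Finset.sum_add_distrib]
  refine Finset.sum_congr rfl fun u _ => Finset.sum_congr rfl fun v _ => ?_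
  obtain ⟨k, a⟩ := u
  obtain ⟨l, b⟩ := v
  by_cases hkl : k = l
  · subst hkl
    have : (∃ (k' : Fin K) (a' b' : Fin (s k')), (⟨k, a⟩ : Nodes s) = ⟨k', a'⟩ ∧
        (⟨k, b⟩ : Nodes s) = ⟨k', b'⟩ ∧ (H k').Adj a' b') ↔ (H k).Adj a b := by
      constructor
      · rintro ⟨k', a', b', h1, h2, h3⟩
        cases h1
        cases h2
        exact h3
      · intro h
        exact ⟨k, a, b, rfl, rfl, h⟩
    simp only [this, hG, centeredAdj, ne_eq, not_true_eq_false, if_false]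
    ring
  · have : ¬ ∃ (k' : Fin K) (a' b' : Fin (s k')), (⟨k, a⟩ : Nodes s) = ⟨k', a'⟩ ∧
        (⟨l, b⟩ : Nodes s) = ⟨k', b'⟩ ∧ (H k').Adj a' b' := by
      rintro ⟨k', a', b', h1, h2, h3⟩
      cases h1
      cases h2
      exact hkl rfl
    simp only [this, if_false, centeredAdj, ne_eq, hkl, not_false_eq_true, if_true]
    split_ifs <;> ring

theorem sum_sum_eq_sum_ordered {F : Nodes s → Nodes s → ℝ}
    (hF : ∀ u v, u.1 = v.1 → F u v = 0) :
    ∑ u, ∑ v, F u v =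
      ∑ e : {e : Nodes s × Nodes s // e.1.1 < e.2.1}, (F e.1.1 e.1.2 + F e.1.2 e.1.1) := by
  rw [← Finset.sum_subtype (Finset.univ.filter fun e : Nodes s × Nodes s => e.1.1 < e.2.1)
    (by simp) (fun e => F e.1 e.2 + F e.2 e.1), Finset.sum_filter, Fintype.sum_prod_type]
  have h : ∀ u v, F u v = (if u.1 < v.1 then F u v else 0) + if v.1 < u.1 then F u v else 0 := by
    intro u v
    rcases lt_trichotomy u.1 v.1 with h | h | h
    · simp [h, h.not_gt]
    · simp [h, hF u v h]
    · simp [h, h.not_gt]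
  calc _ = ∑ u, ∑ v, (if u.1 < v.1 then F u v else 0) +
        ∑ u, ∑ v, (if v.1 < u.1 then F u v else 0) := by
        simp_rw [← Finset.sum_add_distrib]
        exact Finset.sum_congr rfl fun u _ => Finset.sum_congr rfl fun v _ => h u v
    _ = ∑ u, ∑ v, (if u.1 < v.1 then F u v else 0) +
        ∑ u, ∑ v, (if u.1 < v.1 then F v u else 0) := by
        congr 1
        rw [Finset.sum_comm]
    _ = _ := by
        simp_rw [← Finset.sum_add_distrib]
        refine Finset.sum_congr rfl fun u _ => Finset.sum_congr rfl fun v _ => ?_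
        split_ifs <;> simp

end Forms

/-! ### Concentration of the noise between clusters. -/

section Concentration

variable {Ω : Type*} [MeasurableSpace Ω] {μ : Measure Ω}

theorem measureReal_ge_le_of_hasSubgaussianMGF_of_le {X : Ω → ℝ} {c : NNReal}
    (h : HasSubgaussianMGF X c μ) {d : ℝ} (hd : 0 < d) (hcd : c ≤ d) {t : ℝ} (ht : 0 ≤ t) :
    μ.real {ω | t ≤ X ω} ≤ Real.exp (-t ^ 2 / (2 * d)) := by
  have h' : HasSubgaussianMGF X ⟨d, hd.le⟩ μ :=
    { integrable_exp_mul := h.integrable_exp_mul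
      mgf_le := fun u => (h.mgf_le u).trans (by
        rw [Real.exp_le_exp]
        have : (c : ℝ) * u ^ 2 ≤ d * u ^ 2 := mul_le_mul_of_nonneg_right hcd (sq_nonneg u)
        change (c : ℝ) * u ^ 2 / 2 ≤ d * u ^ 2 / 2
        linarith) }
  exact h'.measure_ge_le ht

variable [IsProbabilityMeasure μ] {K : ℕ} {s : Fin K → ℕ} {H : ∀ k, SimpleGraph (Fin (s k))} {p : ℝ}
  {Γ : Ω → SimpleGraph (Nodes s)}

/-- Hoeffding. An edge occurs in both orders, with total coefficient `b = a u v + a v u`; its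
variance proxy `b² / 4` is at most half of `a u v ² + a v u ²`, so the proxies add up to at most `S
/ 2`. -/
theorem IsRIM.measureReal_le_sum_centeredAdj_le (hΓ : IsRIM μ H (fun _ _ => p) Γ)
    (hp : p ∈ Icc (0 : ℝ) 1) (a : Nodes s → Nodes s → ℝ) {S : ℝ} (hS : 0 < S)
    (ha : ∑ u, ∑ v, a u v ^ 2 ≤ S) {t : ℝ} (ht : 0 ≤ t) :
    μ.real {ω | t ≤ ∑ u, ∑ v, a u v * centeredAdj p (Γ ω) u v} ≤ Real.exp (-t ^ 2 / S) := by
  classical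
  let E := {e : Nodes s × Nodes s // e.1.1 < e.2.1}
  let A : E → Set Ω := fun e => {ω | (Γ ω).Adj e.1.1 e.1.2}
  have hA : ∀ e, MeasurableSet (A e) := fun e => hΓ.measurable _ _ e.2
  let X : E → Ω → ℝ := fun e => (A e).indicator fun _ => 1
  let b : E → ℝ := fun e => a e.1.1 e.1.2 + a e.1.2 e.1.1
  have hX : iIndepFun X μ := hΓ.indep.iIndepFun_indicator
  have hXm : ∀ e, Measurable (X e) := fun e => measurable_const.indicator (hA e)
  have hind : iIndepFun (fun e ω => b e * (X e ω - p)) μ :=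
    hX.comp (fun e y => b e * (y - p)) fun e => by fun_prop
  have hmean : ∀ e, μ[X e] = p := by
    intro e
    have h1 : μ[X e] = μ.real (A e) := integral_indicator_one (hA e)
    rw [h1, measureReal_def, hΓ.bernoulli _ _ e.2, ENNReal.toReal_ofReal hp.1]
  have hsub : ∀ e ∈ Finset.univ, HasSubgaussianMGF (fun ω => b e * (X e ω - p))
      (⟨b e ^ 2, sq_nonneg _⟩ * (‖(1 : ℝ) - 0‖₊ / 2) ^ 2) μ := by
    intro e _
    have h1 := hasSubgaussianMGF_of_mem_Icc (μ := μ) (a := 0) (b := 1) (hXm e).aemeasurable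
      (ae_of_all _ fun ω => by
        by_cases h : ω ∈ A e <;> simp [X, h])
    rw [hmean] at h1
    exact h1.const_mul (b e)
  have hsum := HasSubgaussianMGF.sum_of_iIndepFun hind hsub
  have hEq : ∀ ω, ∑ u, ∑ v, a u v * centeredAdj p (Γ ω) u v = ∑ e : E, b e * (X e ω - p) := by
    intro ω
    rw [sum_sum_eq_sum_ordered fun u v h => by simp [centeredAdj, h]]
    refine Finset.sum_congr rfl fun e _ => ?_
    have h1 : centeredAdj p (Γ ω) e.1.1 e.1.2 = X e ω - p := by
      simp only [centeredAdj, ne_eq, e.2.ne, not_false_eq_true, if_true, X, A,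
        Set.indicator_apply, Set.mem_ofPred_eq]
    have h2 : centeredAdj p (Γ ω) e.1.2 e.1.1 = X e ω - p := by
      rw [← h1]
      exact congrFun (congrFun (transpose_centeredAdj p (Γ ω)) e.1.1) e.1.2
    rw [h1, h2, ← add_mul]
  simp_rw [hEq]
  have hS2 : S = 2 * (S / 2) := by ring
  rw [hS2]
  refine measureReal_ge_le_of_hasSubgaussianMGF_of_le hsum (half_pos hS) ?_ ht
  push_cast
  have hb : ∀ e : E, b e ^ 2 * (‖(1 : ℝ) - 0‖ / 2) ^ 2 ≤
      (a e.1.1 e.1.2 ^ 2 + a e.1.2 e.1.1 ^ 2) / 2 := by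
    intro e
    simp only [b, sub_zero, norm_one]
    nlinarith [sq_nonneg (a e.1.1 e.1.2 - a e.1.2 e.1.1)]
  calc _ ≤ ∑ e : E, (a e.1.1 e.1.2 ^ 2 + a e.1.2 e.1.1 ^ 2) / 2 :=
        Finset.sum_le_sum fun e _ => hb e
    _ = (∑ e : E, ((if e.1.1.1 = e.1.2.1 then 0 else a e.1.1 e.1.2 ^ 2) +
          if e.1.2.1 = e.1.1.1 then 0 else a e.1.2 e.1.1 ^ 2)) / 2 := by
        rw [← Finset.sum_div]
        congr 1
        refine Finset.sum_congr rfl fun e _ => ?_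
        rw [if_neg e.2.ne, if_neg e.2.ne']
    _ = (∑ u, ∑ v, if u.1 = v.1 then 0 else a u v ^ 2) / 2 := by
        rw [sum_sum_eq_sum_ordered (F := fun u v => if u.1 = v.1 then 0 else a u v ^ 2)
          fun u v h => by simp [h]]
    _ ≤ (∑ u, ∑ v, a u v ^ 2) / 2 := by
        gcongr with u _ v _
        split_ifs
        · positivity
        · rfl
    _ ≤ S / 2 := by linarith

theorem IsRIM.measureReal_lt_abs_sum_centeredAdj_le (hΓ : IsRIM μ H (fun _ _ => p) Γ)
    (hp : p ∈ Icc (0 : ℝ) 1) (a : Nodes s → Nodes s → ℝ) {S : ℝ} (hS : 0 < S)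
    (ha : ∑ u, ∑ v, a u v ^ 2 ≤ S) {t : ℝ} (ht : 0 ≤ t) :
    μ.real {ω | t < |∑ u, ∑ v, a u v * centeredAdj p (Γ ω) u v|} ≤
      2 * Real.exp (-t ^ 2 / S) := by
  have h1 := hΓ.measureReal_le_sum_centeredAdj_le hp a hS ha ht
  have h2 := hΓ.measureReal_le_sum_centeredAdj_le hp (fun u v => -a u v) hS (by simpa using ha) ht
  have hsub : {ω | t < |∑ u, ∑ v, a u v * centeredAdj p (Γ ω) u v|} ⊆
      {ω | t ≤ ∑ u, ∑ v, a u v * centeredAdj p (Γ ω) u v} ∪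
      {ω | t ≤ ∑ u, ∑ v, -a u v * centeredAdj p (Γ ω) u v} := by
    intro ω hω
    rcases lt_abs.1 (Set.mem_ofPred_eq ▸ hω) with h | h
    · exact Or.inl h.le
    · refine Or.inr ?_
      simp only [Set.mem_ofPred_eq, neg_mul, Finset.sum_neg_distrib]
      exact h.le
  calc _ ≤ _ := measureReal_mono hsub
    _ ≤ _ := measureReal_union_le _ _
    _ ≤ _ := by linarith

theorem IsRIM.measureReal_cut_le (hΓ : IsRIM μ H (fun _ _ => p) Γ) (hp : p ∈ Icc (0 : ℝ) 1)
    {ε : ℝ} (hε : 0 ≤ ε) (hn : 0 < Fintype.card (Nodes s)) (S T : Finset (Nodes s)) :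
    μ.real {ω | ε * (Fintype.card (Nodes s) : ℝ) ^ 2 <
        |∑ u ∈ S, ∑ v ∈ T, centeredAdj p (Γ ω) u v|} ≤
      2 * Real.exp (-(ε ^ 2 * (Fintype.card (Nodes s) : ℝ) ^ 2)) := by
  set n : ℝ := (Fintype.card (Nodes s) : ℝ) with hn'
  have hn0 : 0 < n := Nat.cast_pos.2 hn
  have h := hΓ.measureReal_lt_abs_sum_centeredAdj_le hp
    (fun u v => if u ∈ S then if v ∈ T then 1 else 0 else 0) (S := n ^ 2) (by positivity) (by
      calc _ ≤ ∑ _u : Nodes s, ∑ _v : Nodes s, (1 : ℝ) := by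
            gcongr with u _ v _
            split_ifs <;> norm_num
        _ = n ^ 2 := by simp [hn', sq]) (t := ε * n ^ 2) (by positivity)
  have e : -(ε * n ^ 2) ^ 2 / n ^ 2 = -(ε ^ 2 * n ^ 2) := by field_simp
  rw [e] at h
  convert h using 6 with ω
  simp [Finset.sum_ite_mem, ite_mul]

theorem IsRIM.measureReal_degree_le (hΓ : IsRIM μ H (fun _ _ => p) Γ) (hp : p ∈ Icc (0 : ℝ) 1)
    {ε : ℝ} (hε : 0 ≤ ε) (hn : 0 < Fintype.card (Nodes s)) (u : Nodes s) :
    μ.real {ω | ε * (Fintype.card (Nodes s) : ℝ) < |∑ v, centeredAdj p (Γ ω) u v|} ≤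
      2 * Real.exp (-(ε ^ 2 * (Fintype.card (Nodes s) : ℝ))) := by
  set n : ℝ := (Fintype.card (Nodes s) : ℝ) with hn'
  have hn0 : 0 < n := Nat.cast_pos.2 hn
  have h := hΓ.measureReal_lt_abs_sum_centeredAdj_le hp
    (fun u' _ => if u' = u then 1 else 0) (S := n) hn0 (by simp [hn'])
    (t := ε * n) (by positivity)
  have e : -(ε * n) ^ 2 / n = -(ε ^ 2 * n) := by field_simp
  rw [e] at h
  convert h using 6 with ω
  simp

/-- The event that the noise between clusters is not small. -/
def largeNoise (p ε : ℝ) (Γ : Ω → SimpleGraph (Nodes s)) : Set Ω :=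
  (⋃ ST : Finset (Nodes s) × Finset (Nodes s), {ω | ε * (Fintype.card (Nodes s) : ℝ) ^ 2 <
      |∑ u ∈ ST.1, ∑ v ∈ ST.2, centeredAdj p (Γ ω) u v|}) ∪
    ⋃ u : Nodes s, {ω | ε * (Fintype.card (Nodes s) : ℝ) < |∑ v, centeredAdj p (Γ ω) u v|}

theorem IsRIM.measureReal_largeNoise_le (hΓ : IsRIM μ H (fun _ _ => p) Γ)
    (hp : p ∈ Icc (0 : ℝ) 1) {ε : ℝ} (hε : 0 ≤ ε) (hn : 0 < Fintype.card (Nodes s)) :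
    μ.real (largeNoise p ε Γ) ≤
      4 ^ Fintype.card (Nodes s) *
        (2 * Real.exp (-(ε ^ 2 * (Fintype.card (Nodes s) : ℝ) ^ 2))) +
      Fintype.card (Nodes s) * (2 * Real.exp (-(ε ^ 2 * (Fintype.card (Nodes s) : ℝ)))) := by
  refine (measureReal_union_le _ _).trans (add_le_add ?_ ?_)
  · refine (measureReal_iUnion_fintype_le _).trans ?_
    refine (Finset.sum_le_sum fun ST _ => hΓ.measureReal_cut_le hp hε hn ST.1 ST.2).trans ?_
    rw [Finset.sum_const, nsmul_eq_mul, Finset.card_univ, Fintype.card_prod, Fintype.card_finset,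
      ← mul_pow]
    norm_num
  · refine (measureReal_iUnion_fintype_le _).trans ?_
    refine (Finset.sum_le_sum fun u _ => hΓ.measureReal_degree_le hp hε hn u).trans ?_
    rw [Finset.sum_const, nsmul_eq_mul, Finset.card_univ]

/-- The Gaussian term beats the `4 ^ n` pairs of vertex sets after completing a square. The factor
`n` for the degrees costs half of the exponential rate. -/
theorem exists_bound_exp_neg {ε : ℝ} (hε : 0 < ε) : ∃ C κ : ℝ, 0 < κ ∧ ∀ n : ℕ,
    4 ^ n * (2 * Real.exp (-(ε ^ 2 * (n : ℝ) ^ 2))) + n * (2 * Real.exp (-(ε ^ 2 * (n : ℝ)))) ≤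
      C * Real.exp (-(κ * n)) := by
  set κ : ℝ := ε ^ 2 / 2
  have hκ : 0 < κ := by positivity
  refine ⟨2 * Real.exp ((4 + κ) ^ 2 / (4 * ε ^ 2)) + 2 / κ, κ, hκ, fun n => ?_⟩
  rw [add_mul]
  have h4 : (4 : ℝ) ^ n ≤ Real.exp (4 * n) := by
    rw [mul_comm, Real.exp_nat_mul]
    gcongr
    linarith [Real.add_one_le_exp (4 : ℝ)]
  apply add_le_add
  · calc _ ≤ Real.exp (4 * n) * (2 * Real.exp (-(ε ^ 2 * (n : ℝ) ^ 2))) := by gcongr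
      _ = 2 * Real.exp (4 * n + -(ε ^ 2 * (n : ℝ) ^ 2)) := by rw [Real.exp_add]; ring
      _ ≤ 2 * Real.exp ((4 + κ) ^ 2 / (4 * ε ^ 2) + -(κ * n)) := by
          refine mul_le_mul_of_nonneg_left (Real.exp_le_exp.2 ?_) zero_le_two
          have : (4 + κ) * n ≤ ε ^ 2 * (n : ℝ) ^ 2 + (4 + κ) ^ 2 / (4 * ε ^ 2) := by
            have h5 : ε ^ 2 * (n : ℝ) ^ 2 + (4 + κ) ^ 2 / (4 * ε ^ 2) - (4 + κ) * n =
                (ε * n - (4 + κ) / (2 * ε)) ^ 2 := by field_simp; ring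
            nlinarith [sq_nonneg (ε * n - (4 + κ) / (2 * ε))]
          linarith
      _ = _ := by rw [Real.exp_add]; ring
  · have h6 : (n : ℝ) * κ ≤ Real.exp (κ * n) := by
      linarith [Real.add_one_le_exp (κ * (n : ℝ))]
    have h7 : (n : ℝ) ≤ Real.exp (κ * n) / κ := by rwa [le_div_iff₀ hκ]
    calc _ ≤ Real.exp (κ * n) / κ * (2 * Real.exp (-(ε ^ 2 * (n : ℝ)))) := by gcongr
      _ = 2 / κ * (Real.exp (κ * n) * Real.exp (-(ε ^ 2 * (n : ℝ)))) := by ring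
      _ = _ := by
        rw [← Real.exp_add]
        congr 2
        simp only [κ]
        ring

end Concentration

/-- The sum over all size vectors factors into `K` geometric series. A sequence of distinct size
vectors gives a subseries, as Borel–Cantelli requires. -/
theorem summable_exp_neg_mul_sum (K : ℕ) {κ : ℝ} (hκ : 0 < κ) :
    Summable fun s : Fin K → ℕ => Real.exp (-(κ * ((∑ k, s k : ℕ) : ℝ))) := by
  classical
  set r := Real.exp (-κ)
  have hr0 : 0 ≤ r := (Real.exp_pos _).le
  have hr1 : r < 1 := by
    rw [← Real.exp_zero]
    exact Real.exp_lt_exp.2 (by linarith)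
  have e : ∀ s : Fin K → ℕ, Real.exp (-(κ * ((∑ k, s k : ℕ) : ℝ))) = ∏ k, r ^ s k := by
    intro s
    rw [Finset.prod_pow_eq_pow_sum, ← Real.exp_nat_mul]
    congr 1
    ring
  simp_rw [e]
  refine summable_of_sum_le (c := ∏ _k : Fin K, ∑' j : ℕ, r ^ j)
    (fun s => Finset.prod_nonneg fun k _ => pow_nonneg hr0 _) fun F => ?_
  let M := F.sup fun s => ∑ k, s k
  have hF : F ⊆ Fintype.piFinset fun _ : Fin K => Finset.range (M + 1) := by
    intro s hs
    rw [Fintype.mem_piFinset]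
    intro k
    rw [Finset.mem_range, Nat.lt_succ_iff]
    exact (Finset.single_le_sum (f := s) (fun _ _ => Nat.zero_le _) (Finset.mem_univ k)).trans
      (Finset.le_sup (f := fun s : Fin K → ℕ => ∑ k, s k) hs)
  calc _ ≤ ∑ s ∈ Fintype.piFinset fun _ : Fin K => Finset.range (M + 1), ∏ k, r ^ s k :=
        Finset.sum_le_sum_of_subset_of_nonneg hF fun s _ _ =>
          Finset.prod_nonneg fun k _ => pow_nonneg hr0 _
    _ = ∏ _k : Fin K, ∑ j ∈ Finset.range (M + 1), r ^ j :=
        (Finset.prod_univ_sum (fun _ : Fin K => Finset.range (M + 1)) fun _ j => r ^ j).symm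
    _ ≤ _ := by
        refine Finset.prod_le_prod (fun _ _ => Finset.sum_nonneg fun _ _ => pow_nonneg hr0 _)
          fun _ _ => ?_
        exact (summable_geometric_of_lt_one hr0 hr1).sum_le_tsum _ fun _ _ => pow_nonneg hr0 _

theorem card_nodes {K : ℕ} (s : Fin K → ℕ) : Fintype.card (Nodes s) = numNodes s := by
  simp [Nodes, numNodes]

/-! ### Almost sure uniform approximation by the mean form. -/

section AlmostSure

variable {Ω : Type*} [MeasurableSpace Ω] {μ : Measure Ω} [IsProbabilityMeasure μ]
  {K : ℕ} {N : ℕ → Fin K → ℕ} {H : ∀ m k, SimpleGraph (Fin (N m k))} {p : ℝ}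
  {Γ : ∀ m, Ω → SimpleGraph (Nodes (N m))}

theorem ae_eventually_notMem_largeNoise (hNinj : Function.Injective N)
    (hpos : ∀ m, 0 < numNodes (N m)) (hp : p ∈ Icc (0 : ℝ) 1)
    (hΓ : ∀ m, IsRIM μ (H m) (fun _ _ => p) (Γ m)) {ε : ℝ} (hε : 0 < ε) :
    ∀ᵐ ω ∂μ, ∀ᶠ m in atTop, ω ∉ largeNoise p ε (Γ m) := by
  obtain ⟨C, κ, hκ, hC⟩ := exists_bound_exp_neg hε
  refine ae_eventually_notMem ?_
  have hle : ∀ m, μ.real (largeNoise p ε (Γ m)) ≤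
      C * Real.exp (-(κ * ((∑ k, N m k : ℕ) : ℝ))) := by
    intro m
    have h := (hΓ m).measureReal_largeNoise_le hp hε.le (by rw [card_nodes]; exact hpos m)
    rw [card_nodes] at h
    exact h.trans (hC _)
  have hsum : Summable fun m => C * Real.exp (-(κ * ((∑ k, N m k : ℕ) : ℝ))) :=
    ((summable_exp_neg_mul_sum K hκ).comp_injective hNinj).mul_left C
  have hsum2 : Summable fun m => μ.real (largeNoise p ε (Γ m)) :=
    Summable.of_nonneg_of_le (fun _ => measureReal_nonneg) hle hsum
  have : ∀ m, μ (largeNoise p ε (Γ m)) = ENNReal.ofReal (μ.real (largeNoise p ε (Γ m))) :=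
    fun m => (ofReal_measureReal).symm
  simp_rw [this]
  exact hsum2.tsum_ofReal_ne_top

/-- The quadratic form of the Laplacian of a homogeneous RIM is, up to `o(n)`, deterministic. -/
theorem ae_eventually_abs_sub_le (hNinj : Function.Injective N)
    (hpos : ∀ m, 0 < numNodes (N m)) (hp : p ∈ Icc (0 : ℝ) 1)
    (hΓ : ∀ m, IsRIM μ (H m) (fun _ _ => p) (Γ m)) :
    ∀ᵐ ω ∂μ, ∀ ε > 0, ∀ᶠ m in atTop, ∀ x : Nodes (N m) → ℝ,
      |x ⬝ᵥ laplacian (Γ m ω) *ᵥ x - (internalForm (H m) x + p * multipartiteForm x)| ≤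
        ε * numNodes (N m) * (x ⬝ᵥ x) := by
  -- Countably many levels `η = 1 / (i + 1)` suffice for one null set. Degrees need the bound `η`,
  -- cuts need `η⁴ / 4`; the resulting form bound is `2 η`.
  have h : ∀ i : ℕ, ∀ᵐ ω ∂μ, ∀ᶠ m in atTop,
      ω ∉ largeNoise p (min (1 / ((i : ℝ) + 1)) ((1 / ((i : ℝ) + 1)) ^ 4 / 4)) (Γ m) :=
    fun i => ae_eventually_notMem_largeNoise hNinj hpos hp hΓ (by positivity)
  filter_upwards [ae_all_iff.2 h] with ω hω ε hε
  obtain ⟨i, hi⟩ := exists_nat_one_div_lt (half_pos hε)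
  filter_upwards [hω i] with m hm x
  set η : ℝ := 1 / ((i : ℝ) + 1)
  have hη : 0 ≤ η := by positivity
  simp only [largeNoise, Set.mem_union, Set.mem_iUnion, Set.mem_ofPred_eq, not_or, not_exists,
    not_lt] at hm
  have hx := dotProduct_self_nonneg_real x
  have key := abs_sum_sum_mul_sub_sq_le (transpose_centeredAdj p (Γ m ω))
    (abs_centeredAdj_le hp (Γ m ω)) hη
    (fun S T => (hm.1 (S, T)).trans (by gcongr; exact min_le_right _ _))
    (fun u => (hm.2 u).trans (by gcongr; exact min_le_left _ _)) x
  rw [dotProduct_laplacian_mulVec_eq (fun k u v => (hΓ m).internal ω k u v) p x, add_sub_cancel_left]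
  refine key.trans ?_
  rw [card_nodes]
  gcongr
  linarith

end AlmostSure

/-! ### Cluster means and the multipartite form. -/

section ClusterForms

theorem sum_sum_sub_sq {V : Type*} [Fintype V] (y : V → ℝ) :
    ∑ i, ∑ j, (y i - y j) ^ 2 = 2 * (Fintype.card V * ∑ i, y i ^ 2 - (∑ i, y i) ^ 2) := by
  have h : ∀ i j, (y i - y j) ^ 2 = y i ^ 2 + y j ^ 2 - 2 * (y i * y j) := fun i j => by ring
  simp_rw [h, Finset.sum_sub_distrib, Finset.sum_add_distrib, ← Finset.mul_sum, ← Finset.sum_mul,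
    Finset.sum_const, Finset.card_univ, nsmul_eq_mul, ← Finset.mul_sum]
  ring

variable {K : ℕ} {s : Fin K → ℕ}

theorem multipartiteForm_eq (x : Nodes s → ℝ) :
    multipartiteForm x = numNodes s * (x ⬝ᵥ x) - (∑ u, x u) ^ 2 -
      ∑ k, (s k * ∑ a, x ⟨k, a⟩ ^ 2 - (∑ a, x ⟨k, a⟩) ^ 2) := by
  have h1 : ∀ u v : Nodes s, (if u.1 ≠ v.1 then (x u - x v) ^ 2 else 0) =
      (x u - x v) ^ 2 - if v.1 = u.1 then (x u - x v) ^ 2 else 0 := by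
    intro u v
    by_cases h : u.1 = v.1
    · simp [h]
    · simp [h, Ne.symm h]
  have h2 : ∑ u : Nodes s, ∑ v : Nodes s, (if v.1 = u.1 then (x u - x v) ^ 2 else 0) =
      ∑ k, ∑ a, ∑ b, (x ⟨k, a⟩ - x ⟨k, b⟩) ^ 2 := by
    rw [Fintype.sum_sigma]
    refine Finset.sum_congr rfl fun k _ => Finset.sum_congr rfl fun a _ => ?_
    rw [Fintype.sum_sigma, Finset.sum_eq_single k]
    · simp
    · intro l _ hl
      simp [hl]
    · simp
  have h3 : x ⬝ᵥ x = ∑ u, x u ^ 2 := by simp [dotProduct, sq]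
  rw [multipartiteForm]
  simp_rw [h1, Finset.sum_sub_distrib]
  rw [h2, sum_sum_sub_sq, h3, card_nodes]
  simp_rw [sum_sum_sub_sq, Fintype.card_fin, ← Finset.mul_sum, Finset.sum_sub_distrib]
  ring

/-- The projection onto the vectors that are constant on every cluster. -/
noncomputable def clusterMean (x : Nodes s → ℝ) : Nodes s → ℝ :=
  fun u => (∑ a, x ⟨u.1, a⟩) / s u.1

/-- `∑ₖ sₖ ‖x_k‖²`, the squared norm weighted by the cluster sizes. -/
def weightedSq (x : Nodes s → ℝ) : ℝ := ∑ k, s k * ∑ a, x ⟨k, a⟩ ^ 2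

theorem sum_sub_clusterMean (hs : ∀ k, 0 < s k) (x : Nodes s → ℝ) (k : Fin K) :
    ∑ a, (x - clusterMean x) ⟨k, a⟩ = 0 := by
  have : (s k : ℝ) ≠ 0 := Nat.cast_ne_zero.2 (hs k).ne'
  have hc : ∀ a, clusterMean x ⟨k, a⟩ = (∑ a, x ⟨k, a⟩) / s k := fun _ => rfl
  simp only [Pi.sub_apply, hc, Finset.sum_sub_distrib, Finset.sum_const,
    Finset.card_univ, Fintype.card_fin, nsmul_eq_mul]
  field_simp
  ring

theorem sum_clusterMean (hs : ∀ k, 0 < s k) (x : Nodes s → ℝ) :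
    ∑ u, clusterMean x u = ∑ u, x u := by
  have h : ∑ u, (x - clusterMean x) u = 0 := by
    rw [Fintype.sum_sigma]
    exact Finset.sum_eq_zero fun k _ => sum_sub_clusterMean hs x k
  simp only [Pi.sub_apply, Finset.sum_sub_distrib] at h
  linarith

theorem dotProduct_self_eq_add (hs : ∀ k, 0 < s k) (x : Nodes s → ℝ) :
    x ⬝ᵥ x = clusterMean x ⬝ᵥ clusterMean x +
      (x - clusterMean x) ⬝ᵥ (x - clusterMean x) := by
  have h : clusterMean x ⬝ᵥ (x - clusterMean x) = 0 := by
    rw [dotProduct, Fintype.sum_sigma]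
    refine Finset.sum_eq_zero fun k _ => ?_
    have : ∀ a, clusterMean x ⟨k, a⟩ = (∑ a, x ⟨k, a⟩) / s k := fun a => rfl
    simp_rw [this, ← Finset.mul_sum, sum_sub_clusterMean hs, mul_zero]
  have e : x ⬝ᵥ x = (clusterMean x + (x - clusterMean x)) ⬝ᵥ
      (clusterMean x + (x - clusterMean x)) := by simp
  rw [e, add_dotProduct, dotProduct_add, dotProduct_add, dotProduct_comm (x - clusterMean x)
    (clusterMean x), h]
  ring

theorem internalForm_congr_add (H : ∀ k, SimpleGraph (Fin (s k))) (x : Nodes s → ℝ)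
    (g : Fin K → ℝ) : internalForm H (fun u => x u + g u.1) = internalForm H x := by
  unfold internalForm
  congr 1
  refine Finset.sum_congr rfl fun u _ => Finset.sum_congr rfl fun v _ => ?_
  split_ifs with h
  · obtain ⟨k, a, b, rfl, rfl, -⟩ := h
    ring
  · rfl

theorem internalForm_const (H : ∀ k, SimpleGraph (Fin (s k))) (g : Fin K → ℝ) :
    internalForm H (fun u => g u.1) = 0 := by
  have h := internalForm_congr_add H 0 g
  simp only [Pi.zero_apply, zero_add] at h
  rw [h]
  simp [internalForm]

theorem internalForm_sub_clusterMean (H : ∀ k, SimpleGraph (Fin (s k))) (x : Nodes s → ℝ) :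
    internalForm H (x - clusterMean x) = internalForm H x := by
  rw [← internalForm_congr_add H x fun k => -((∑ a, x ⟨k, a⟩) / s k)]
  congr 1

theorem multipartiteForm_const_le (g : Fin K → ℝ) :
    multipartiteForm (s := s) (fun u => g u.1) ≤
      numNodes s * ((fun u : Nodes s => g u.1) ⬝ᵥ fun u => g u.1) := by
  rw [multipartiteForm_eq]
  have : ∑ k, ((s k : ℝ) * ∑ _a : Fin (s k), g k ^ 2 - (∑ _a : Fin (s k), g k) ^ 2) = 0 := by
    refine Finset.sum_eq_zero fun k _ => ?_
    simp
    ring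
  rw [this]
  nlinarith [sq_nonneg (∑ u : Nodes s, g u.1)]

/-- The complete multipartite graph is the complete graph minus the cliques on the clusters; the
clique forms see only the deviation from cluster means. -/
theorem multipartiteForm_centered (hs : ∀ k, 0 < s k) {x : Nodes s → ℝ} (hx : ∑ u, x u = 0) :
    multipartiteForm x = numNodes s * (x ⬝ᵥ x) - weightedSq (x - clusterMean x) := by
  rw [multipartiteForm_eq, hx, weightedSq]
  have h : ∀ k, (s k : ℝ) * ∑ a, x ⟨k, a⟩ ^ 2 - (∑ a, x ⟨k, a⟩) ^ 2 =
      s k * ∑ a, (x - clusterMean x) ⟨k, a⟩ ^ 2 := by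
    intro k
    have hk : (s k : ℝ) ≠ 0 := Nat.cast_ne_zero.2 (hs k).ne'
    have e : ∀ a, (x - clusterMean x) ⟨k, a⟩ ^ 2 = x ⟨k, a⟩ ^ 2 -
        2 * ((∑ a, x ⟨k, a⟩) / s k) * x ⟨k, a⟩ + ((∑ a, x ⟨k, a⟩) / s k) ^ 2 := by
      intro a
      simp only [Pi.sub_apply, clusterMean]
      ring
    simp_rw [e, Finset.sum_add_distrib, Finset.sum_sub_distrib, ← Finset.mul_sum]
    simp
    field_simp
    ring
  simp_rw [h]
  ring

theorem clusterMean_sub_clusterMean (hs : ∀ k, 0 < s k) (x : Nodes s → ℝ) :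
    clusterMean (x - clusterMean x) = 0 := by
  ext u
  rw [clusterMean, sum_sub_clusterMean hs, zero_div, Pi.zero_apply]

theorem mul_dotProduct_self_le_weightedSq {t : ℝ} (ht : ∀ k, t ≤ s k) (x : Nodes s → ℝ) :
    t * (x ⬝ᵥ x) ≤ weightedSq x := by
  rw [dotProduct, Fintype.sum_sigma, weightedSq, Finset.mul_sum]
  refine Finset.sum_le_sum fun k _ => ?_
  simp_rw [← sq]
  gcongr
  exact ht k

end ClusterForms

/-! ### Deterministic consequences of closeness to the mean form. -/

section Deterministic

variable {r : ℕ} {s : Fin (r + 1) → ℕ} {H : ∀ k, SimpleGraph (Fin (s k))}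

/-- The quadratic form of the Laplacian of `G` is `ε n`-close to its mean under a homogeneous RIM
with internal graphs `H` and parameter `p`. -/
def IsNearMean (H : ∀ k, SimpleGraph (Fin (s k))) (p ε : ℝ) (G : SimpleGraph (Nodes s)) : Prop :=
  ∀ x : Nodes s → ℝ, |x ⬝ᵥ laplacian G *ᵥ x - (internalForm H x + p * multipartiteForm x)| ≤
    ε * numNodes s * (x ⬝ᵥ x)

variable {p ε : ℝ} {G : SimpleGraph (Nodes s)}

theorem IsNearMean.const_le (hG : IsNearMean H p ε G) (hp : 0 ≤ p) (g : Fin (r + 1) → ℝ) :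
    (fun u : Nodes s => g u.1) ⬝ᵥ laplacian G *ᵥ (fun u : Nodes s => g u.1) ≤
      (p + ε) * numNodes s * ((fun u : Nodes s => g u.1) ⬝ᵥ fun u => g u.1) := by
  have h := (abs_le.1 (hG fun u => g u.1)).2
  rw [internalForm_const, zero_add] at h
  have := mul_le_mul_of_nonneg_left (multipartiteForm_const_le (s := s) g) hp
  linarith

theorem add_one_le_numNodes (hs : ∀ k, 0 < s k) : r + 1 ≤ numNodes s := by
  calc r + 1 = ∑ _k : Fin (r + 1), 1 := by simp
    _ ≤ _ := Finset.sum_le_sum fun k _ => hs k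

/-- Min-max with the `(r+1)`-dimensional space of cluster-constant vectors. -/
theorem IsNearMean.eigval_le (hG : IsNearMean H p ε G) (hs : ∀ k, 0 < s k) (hp : 0 ≤ p) :
    eigval (laplacian G) (r + 1) ≤ (p + ε) * numNodes s := by
  refine eigval_le_of_forall_le (isHermitian_laplacian G)
    (by rw [card_nodes]; exact add_one_le_numNodes hs)
    { toFun := fun g (u : Nodes s) => g u.1
      map_add' := fun _ _ => rfl
      map_smul' := fun _ _ => rfl } (fun g g' h => ?_) fun g => hG.const_le hp g
  ext k
  exact congrFun h ⟨k, ⟨0, hs k⟩⟩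

theorem IsNearMean.eigval_two_bounds (hG : IsNearMean H p ε G) (hr : 1 ≤ r) (hs : ∀ k, 0 < s k)
    (hp : 0 ≤ p) (hS : (r * p - ε) * numNodes s ≤ partialEigSum (r + 1) (laplacian G)) :
    (p - r * ε) * numNodes s ≤ eigval (laplacian G) 2 ∧
      eigval (laplacian G) 2 ≤ (p + ε) * numNodes s := by
  have hc : r + 1 ≤ Fintype.card (Nodes s) := by rw [card_nodes]; exact add_one_le_numNodes hs
  have hK := hG.eigval_le hs hp
  have hle : ∀ i ∈ Finset.Icc 2 (r + 1), eigval (laplacian G) i ≤ (p + ε) * numNodes s := by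
    intro i hi
    rw [Finset.mem_Icc] at hi
    exact (eigval_mono (isHermitian_laplacian G) (by omega) hi.2 hc).trans hK
  refine ⟨?_, hle 2 (Finset.mem_Icc.2 ⟨le_rfl, by omega⟩)⟩
  rw [partialEigSum, ← Finset.add_sum_erase _ _ (Finset.mem_Icc.2 ⟨le_rfl, by omega⟩)] at hS
  have h2 : ∑ i ∈ (Finset.Icc 2 (r + 1)).erase 2, eigval (laplacian G) i ≤
      (r - 1 : ℝ) * ((p + ε) * numNodes s) := by
    refine (Finset.sum_le_card_nsmul _ _ _ fun i hi => hle i (Finset.mem_of_mem_erase hi)).trans_eq ?_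
    rw [nsmul_eq_mul, Finset.card_erase_of_mem (Finset.mem_Icc.2 ⟨le_rfl, by omega⟩),
      Nat.card_Icc]
    congr 1
    rw [show r + 1 + 1 - 2 - 1 = r - 1 by omega, Nat.cast_sub hr, Nat.cast_one]
  -- `λ_2` is the sum minus the other `r - 1` terms: `(r p - ε) - (r - 1)(p + ε) = p - r ε`.
  nlinarith

/-- A centred vector with small Rayleigh quotient is almost constant on the clusters, if the
spectral gap `λ₂` is still close to `q' n` at some larger parameter `q'`. -/
theorem mul_weightedSq_le {q q' : ℝ} {G' : SimpleGraph (Nodes s)} (hG : IsNearMean H q ε G)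
    (hG' : IsNearMean H q' ε G') (hs : ∀ k, 0 < s k) (hn : 2 ≤ numNodes s)
    (hε : 0 ≤ ε) (h2 : (q' - ε) * numNodes s ≤ eigval (laplacian G') 2)
    {z : Nodes s → ℝ} (hz : ∑ u, z u = 0) (hz1 : z ⬝ᵥ z = 1)
    (hR : z ⬝ᵥ laplacian G *ᵥ z ≤ (q + ε) * numNodes s) :
    (q' - q) * weightedSq (z - clusterMean z) ≤ 4 * ε * numNodes s := by
  set w := z - clusterMean z with hw
  have hws : ∑ u, w u = 0 := by
    rw [Fintype.sum_sigma]
    exact Finset.sum_eq_zero fun k _ => sum_sub_clusterMean hs z k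
  have hww : w - clusterMean w = w := by rw [hw, clusterMean_sub_clusterMean hs, sub_zero]
  -- The internal form of `w` is the same at both parameters: at `q'` it is at least `q' *
  -- weightedSq w - 2 ε n`, at `q` at most `q * weightedSq w + 2 ε n`.
  have e1 := (abs_le.1 (hG' w)).2
  rw [multipartiteForm_centered hs hws, hww] at e1
  have e2 := eigval_two_mul_le G' (by rw [card_nodes]; exact hn) hws
  have e3 := (abs_le.1 (hG z)).1
  rw [multipartiteForm_centered hs hz, ← internalForm_sub_clusterMean, ← hw, hz1] at e3
  have hw0 := dotProduct_self_nonneg_real w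
  have hw1 : w ⬝ᵥ w ≤ 1 := by
    have := dotProduct_self_eq_add hs z
    rw [hz1, ← hw] at this
    linarith [dotProduct_self_nonneg_real (clusterMean z)]
  have e4 := mul_le_mul_of_nonneg_right h2 hw0
  have e5 : ε * numNodes s * (w ⬝ᵥ w) ≤ ε * numNodes s * 1 := by gcongr
  nlinarith

theorem IsNearMean.dotProduct_sub_le (hG : IsNearMean H p ε G) (hs : ∀ k, 0 < s k)
    (hn : 2 ≤ numNodes s) (hp : 0 ≤ p) (hε : 0 ≤ ε)
    (h2 : (p - ε) * numNodes s ≤ eigval (laplacian G) 2)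
    {z : Nodes s → ℝ} (hz : ∑ u, z u = 0) (hz1 : z ⬝ᵥ z = 1) :
    z ⬝ᵥ laplacian G *ᵥ z - eigval (laplacian G) 2 ≤
      4 * numNodes s * (ε + (z - clusterMean z) ⬝ᵥ (z - clusterMean z)) := by
  have hV : 2 ≤ Fintype.card (Nodes s) := by rw [card_nodes]; exact hn
  set w := z - clusterMean z with hw
  set c := clusterMean z with hc
  have hzcw : z = c + w := by simp [hw]
  have hcs : ∑ u, c u = 0 := (sum_clusterMean hs z).trans hz
  have hws : ∑ u, w u = 0 := by simp [hw, Finset.sum_sub_distrib, hz, hcs]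
  have hsum : c ⬝ᵥ c + w ⬝ᵥ w = 1 := by rw [← hz1, dotProduct_self_eq_add hs z]
  have h3 := eigval_two_mul_le G hV (x := c - w) (by simp [Finset.sum_sub_distrib, hcs, hws])
  have h4 := hG.const_le hp fun k => (∑ a, z ⟨k, a⟩) / s k
  change c ⬝ᵥ laplacian G *ᵥ c ≤ (p + ε) * numNodes s * (c ⬝ᵥ c) at h4
  have h5 := dotProduct_laplacian_mulVec_le G w
  rw [card_nodes] at h5
  -- The parallelogram law avoids estimating the cross term: the reflected vector `c - w` is also
  -- centred of norm 1, so its form is at least `λ_2`.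
  have h6 : z ⬝ᵥ laplacian G *ᵥ z + (c - w) ⬝ᵥ laplacian G *ᵥ (c - w) =
      2 * (c ⬝ᵥ laplacian G *ᵥ c) + 2 * (w ⬝ᵥ laplacian G *ᵥ w) := by
    rw [hzcw]
    simp only [Matrix.mulVec_sub, Matrix.mulVec_add, sub_dotProduct, dotProduct_sub,
      add_dotProduct, dotProduct_add]
    ring
  have h7 : z ⬝ᵥ z + (c - w) ⬝ᵥ (c - w) = 2 * (c ⬝ᵥ c) + 2 * (w ⬝ᵥ w) := by
    rw [hzcw]
    simp only [sub_dotProduct, dotProduct_sub, add_dotProduct, dotProduct_add]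
    ring
  set τ := eigval (laplacian G) 2
  have hτ : 0 ≤ τ := eigval_two_nonneg G hV
  have hcc := dotProduct_self_nonneg_real c
  have hww := dotProduct_self_nonneg_real w
  have hc1 : c ⬝ᵥ c ≤ 1 := by linarith
  have h8 : (c - w) ⬝ᵥ (c - w) = 1 := by linarith
  rw [h8] at h3
  have h9 := mul_le_mul_of_nonneg_right h2 hcc
  have h10 : 2 * ε * numNodes s * (c ⬝ᵥ c) ≤ 2 * ε * numNodes s * 1 := by gcongr
  have h11 : 0 ≤ τ * (w ⬝ᵥ w) := by positivity
  have h12 : τ = τ * (c ⬝ᵥ c) + τ * (w ⬝ᵥ w) := by rw [← mul_add, hsum, mul_one]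
  nlinarith

end Deterministic

/-! ### Subcriticality and cluster proportions. -/

section Transfer

/-- Subcriticality, transferred to probability spaces in any universe. -/
theorem IsSubcritical.ae_tendsto {K : ℕ} {N : ℕ → Fin K → ℕ}
    {H : ∀ m k, SimpleGraph (Fin (N m k))} {p : ℝ} (h : IsSubcritical N H p) {Ω : Type*}
    [MeasurableSpace Ω] {μ : Measure Ω} [IsProbabilityMeasure μ]
    {Γ : ∀ m, Ω → SimpleGraph (Nodes (N m))} (hΓ : ∀ m, IsRIM μ (H m) (fun _ _ => p) (Γ m)) :
    ∀ᵐ ω ∂μ, Tendsto (fun m => partialEigSum K (laplacian (Γ m ω)) / (numNodes (N m) : ℝ))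
      atTop (𝓝 (((K : ℝ) - 1) * p)) := by
  -- Only edges between clusters are random. Recording them maps `Ω` to a canonical space in `Type`;
  -- the image measure retains the joint law over all `m`, and the graphs are rebuilt there.
  let F : Ω → ∀ m, Nodes (N m) → Nodes (N m) → Prop := fun ω m u v => u.1 < v.1 ∧ (Γ m ω).Adj u v
  let Γ' : ∀ m, (∀ m, Nodes (N m) → Nodes (N m) → Prop) → SimpleGraph (Nodes (N m)) := fun m ω =>
    { Adj := fun u v => (∃ (k : Fin K) (a b : Fin (N m k)), u = ⟨k, a⟩ ∧ v = ⟨k, b⟩ ∧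
        (H m k).Adj a b) ∨ (u.1 < v.1 ∧ ω m u v) ∨ (v.1 < u.1 ∧ ω m v u)
      symm := ⟨by
        rintro u v (⟨k, a, b, h1, h2, h3⟩ | h | h)
        · exact Or.inl ⟨k, b, a, h2, h1, h3.symm⟩
        · exact Or.inr (Or.inr h)
        · exact Or.inr (Or.inl h)⟩
      loopless := ⟨by
        rintro u (⟨k, a, b, h1, h2, h3⟩ | h | h)
        · rw [h1] at h2
          cases h2
          exact (H m k).loopless.irrefl _ h3
        · exact h.1.false
        · exact h.1.false⟩ }
  have hF : Measurable F := by
    refine measurable_pi_iff.2 fun m => measurable_pi_iff.2 fun u => measurable_pi_iff.2 fun v => ?_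
    by_cases huv : u.1 < v.1
    · simp only [F, huv, true_and]
      exact measurableSet_setOfPred.1 ((hΓ m).measurable u v huv)
    · simp only [F, huv, false_and]
      exact measurable_const
  have hnot : ∀ {m} {u v : Nodes (N m)}, u.1 ≠ v.1 → ¬ ∃ (k : Fin K) (a b : Fin (N m k)),
      u = ⟨k, a⟩ ∧ v = ⟨k, b⟩ ∧ (H m k).Adj a b := by
    rintro m u v huv ⟨k, a, b, rfl, rfl, -⟩
    exact huv rfl
  have hin : ∀ {m} {k : Fin K} {a b : Fin (N m k)}, (∃ (k' : Fin K) (a' b' : Fin (N m k')),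
      (⟨k, a⟩ : Nodes (N m)) = ⟨k', a'⟩ ∧ (⟨k, b⟩ : Nodes (N m)) = ⟨k', b'⟩ ∧
        (H m k').Adj a' b') ↔ (H m k).Adj a b := by
    intro m k a b
    constructor
    · rintro ⟨k', a', b', h1, h2, h3⟩
      cases h1
      cases h2
      exact h3
    · exact fun h => ⟨k, a, b, rfl, rfl, h⟩
  have hset : ∀ m (e f : Nodes (N m)), e.1 < f.1 →
      {ω | (Γ' m ω).Adj e f} = {ω | ω m e f} := by
    intro m e f hef
    ext ω
    simp only [Γ', Set.mem_ofPred_eq, hnot hef.ne, hef, hef.not_gt, true_and, false_and, false_or,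
      or_false]
  have hmeas : ∀ m (e f : Nodes (N m)), e.1 < f.1 → MeasurableSet {ω | (Γ' m ω).Adj e f} := by
    intro m e f hef
    rw [hset m e f hef]
    refine measurableSet_setOfPred.2 ?_
    exact (measurable_pi_apply f).comp ((measurable_pi_apply e).comp (measurable_pi_apply m))
  have hpre : ∀ m (e f : Nodes (N m)), e.1 < f.1 →
      F ⁻¹' {ω | (Γ' m ω).Adj e f} = {ω | (Γ m ω).Adj e f} := by
    intro m e f hef
    rw [hset m e f hef]
    ext ω
    simp [F, hef]
  have : IsProbabilityMeasure (μ.map F) := Measure.isProbabilityMeasure_map hF.aemeasurable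
  have hΓ' : ∀ m, IsRIM (μ.map F) (H m) (fun _ _ => p) (Γ' m) := by
    intro m
    refine ⟨(hΓ m).connected, fun ω k u v => ?_, hmeas m, fun e f hef => ?_, ?_⟩
    · simp only [Γ', lt_self_iff_false, false_and, or_false]
      exact hin
    · rw [Measure.map_apply hF (hmeas m e f hef), hpre m e f hef]
      exact (hΓ m).bernoulli e f hef
    · rw [iIndepSet_iff_meas_biInter fun e => hmeas m _ _ e.2]
      intro S
      rw [Measure.map_apply hF (Finset.measurableSet_biInter _ fun e _ => hmeas m _ _ e.2)]
      have hpre' : ∀ e : {e : Nodes (N m) × Nodes (N m) // e.1.1 < e.2.1},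
          F ⁻¹' {ω | (Γ' m ω).Adj e.1.1 e.1.2} = {ω | (Γ m ω).Adj e.1.1 e.1.2} :=
        fun e => hpre m _ _ e.2
      have hmap : ∀ e : {e : Nodes (N m) × Nodes (N m) // e.1.1 < e.2.1},
          μ.map F {ω | (Γ' m ω).Adj e.1.1 e.1.2} = μ {ω | (Γ m ω).Adj e.1.1 e.1.2} := by
        intro e
        rw [Measure.map_apply hF (hmeas m _ _ e.2), hpre']
      simp_rw [Set.preimage_iInter, hpre', hmap]
      exact (iIndepSet_iff_meas_biInter fun e => (hΓ m).measurable _ _ e.2).1 (hΓ m).indep S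
  have key := ae_of_ae_map hF.aemeasurable (h _ (μ.map F) Γ' hΓ')
  filter_upwards [key] with ω hω
  have heq : ∀ m, Γ' m (F ω) = Γ m ω := by
    intro m
    ext ⟨k, a⟩ ⟨l, b⟩
    rcases lt_trichotomy k l with hkl | rfl | hkl
    · simp only [Γ', F, hnot (u := ⟨k, a⟩) (v := ⟨l, b⟩) hkl.ne, hkl, hkl.not_gt, true_and,
        false_and, false_or, or_false]
    · rw [(hΓ m).internal ω k a b]
      simp only [Γ', lt_self_iff_false, false_and, or_false]
      exact hin
    · simp only [Γ', F, hnot (u := ⟨k, a⟩) (v := ⟨l, b⟩) hkl.ne', hkl, hkl.not_gt, true_and,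
        false_and, false_or]
      exact (Γ m ω).adj_comm _ _
  simpa only [heq] using hω

theorem exists_isSubcritical_of_lt {K : ℕ} {N : ℕ → Fin K → ℕ}
    {H : ∀ m k, SimpleGraph (Fin (N m k))} {p : ℝ} (hp : 0 ≤ p) (h : p < criticalThreshold N H) :
    IsSubcritical N H p ∧ ∃ q ∈ Icc (0 : ℝ) 1, p < q ∧ IsSubcritical N H q := by
  -- The supremum of the empty set is 0, which `0 ≤ p < p*` excludes.
  have hne : {q : ℝ | q ∈ Icc (0 : ℝ) 1 ∧ ∀ p ∈ Icc (0 : ℝ) q, IsSubcritical N H p}.Nonempty := by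
    by_contra hemp
    rw [Set.not_nonempty_iff_eq_empty] at hemp
    rw [criticalThreshold, hemp, Real.sSup_empty] at h
    exact absurd h (not_lt.2 hp)
  obtain ⟨q, ⟨hq1, hq2⟩, hpq⟩ := exists_lt_of_lt_csSup hne h
  exact ⟨hq2 p ⟨hp, hpq.le⟩, q, hq1, hpq, hq2 q ⟨hq1.1, le_rfl⟩⟩

theorem exists_pos_mul_numNodes_le {r : ℕ} {N : ℕ → Fin (r + 1) → ℕ} (hpos : ∀ m k, 0 < N m k)
    {c : ℝ} (hc : 0 < c)
    (hratio : Tendsto (fun m => (⨅ k, (N m k : ℝ)) / (⨆ k, (N m k : ℝ))) atTop (𝓝 c)) :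
    ∃ d : ℝ, 0 < d ∧ ∀ᶠ m in atTop, ∀ k, d * numNodes (N m) ≤ N m k := by
  refine ⟨c / 2 / (r + 1), by positivity, ?_⟩
  filter_upwards [hratio.eventually_const_lt (half_lt_self hc)] with m hm k
  have hsup : ∀ j, (N m j : ℝ) ≤ ⨆ k, (N m k : ℝ) := fun j =>
    le_ciSup (f := fun k => (N m k : ℝ)) (Set.finite_range _).bddAbove j
  have hinf : (⨅ k, (N m k : ℝ)) ≤ N m k :=
    ciInf_le (f := fun k => (N m k : ℝ)) (Set.finite_range _).bddBelow k
  have h0 : 0 < ⨆ k, (N m k : ℝ) := (Nat.cast_pos.2 (hpos m 0)).trans_le (hsup 0)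
  rw [lt_div_iff₀ h0] at hm
  have hn : (numNodes (N m) : ℝ) ≤ (r + 1) * ⨆ k, (N m k : ℝ) := by
    rw [numNodes, Nat.cast_sum]
    refine (Finset.sum_le_card_nsmul _ _ _ fun j _ => hsup j).trans_eq ?_
    simp
  calc c / 2 / (r + 1) * numNodes (N m) ≤ c / 2 / (r + 1) * ((r + 1) * ⨆ k, (N m k : ℝ)) := by
        gcongr
    _ = c / 2 * ⨆ k, (N m k : ℝ) := by field_simp
    _ ≤ _ := hm.le.trans hinf

end Transfer

/-! ### Passage to the limit. -/

section Asymptotics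

variable {r : ℕ} {N : ℕ → Fin (r + 1) → ℕ} {H : ∀ m k, SimpleGraph (Fin (N m k))}

theorem eventually_eigval_two_bounds (hr : 1 ≤ r) (hpos : ∀ m k, 0 < N m k) {p : ℝ} (hp : 0 ≤ p)
    {G : ∀ m, SimpleGraph (Nodes (N m))} (hG : ∀ ε > 0, ∀ᶠ m in atTop, IsNearMean (H m) p ε (G m))
    (hS : Tendsto (fun m => partialEigSum (r + 1) (laplacian (G m)) / (numNodes (N m) : ℝ))
      atTop (𝓝 (r * p))) {ε : ℝ} (hε : 0 < ε) :
    ∀ᶠ m in atTop, (p - ε) * numNodes (N m) ≤ eigval (laplacian (G m)) 2 ∧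
      eigval (laplacian (G m)) 2 ≤ (p + ε) * numNodes (N m) := by
  have hr' : (1 : ℝ) ≤ r := by exact_mod_cast hr
  have hε' : 0 < ε / r := by positivity
  filter_upwards [hG _ hε', hS.eventually_const_lt (sub_lt_self (r * p) hε')] with m h1 h2
  have hn : (0 : ℝ) < numNodes (N m) :=
    Nat.cast_pos.2 (Nat.succ_pos r |>.trans_le (add_one_le_numNodes (hpos m)))
  rw [lt_div_iff₀ hn] at h2
  obtain ⟨h3, h4⟩ := h1.eigval_two_bounds hr (hpos m) hp h2.le
  rw [mul_div_cancel₀ _ (by positivity : (r : ℝ) ≠ 0)] at h3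
  refine ⟨h3, h4.trans ?_⟩
  gcongr
  exact div_le_self hε.le hr'

theorem limsup_ofReal_le_div {a f g e h : ℕ → ℝ} {δ : ℝ} {b : ℝ≥0∞} (hδ : 0 < δ)
    (hg : Tendsto g atTop (𝓝 δ)) (he : Tendsto e atTop (𝓝 0)) (hh : Tendsto h atTop (𝓝 0))
    (hf : Tendsto (fun m => ENNReal.ofReal (f m)) atTop (𝓝 b)) (hf0 : ∀ m, 0 ≤ f m)
    (hh0 : ∀ m, 0 ≤ h m) (hle : ∀ᶠ m in atTop, (g m - e m) * a m ≤ f m + h m) :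
    limsup (fun m => ENNReal.ofReal (a m)) atTop ≤ b / ENNReal.ofReal δ := by
  have hge : Tendsto (fun m => g m - e m) atTop (𝓝 δ) := by simpa using hg.sub he
  have hlim : Tendsto (fun m => (ENNReal.ofReal (f m) + ENNReal.ofReal (h m)) /
      ENNReal.ofReal (g m - e m)) atTop (𝓝 (b / ENNReal.ofReal δ)) := by
    refine ENNReal.Tendsto.div ?_ (Or.inr (by simpa using hδ)) (ENNReal.tendsto_ofReal hge)
      (Or.inl ENNReal.ofReal_ne_top)
    simpa using hf.add (ENNReal.tendsto_ofReal hh)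
  rw [← hlim.limsup_eq]
  refine limsup_le_limsup ?_
  filter_upwards [hle, hge.eventually_const_lt hδ] with m h1 h2
  rw [← ENNReal.ofReal_add (hf0 m) (hh0 m), ← ENNReal.ofReal_div_of_pos h2]
  exact ENNReal.ofReal_le_ofReal ((le_div_iff₀' h2).2 h1)

theorem limsup_sinThetaNorm_le (hr : 1 ≤ r) (hpos : ∀ m k, 0 < N m k)
    (hn : Tendsto (fun m => numNodes (N m)) atTop atTop) {d : ℝ} (hd : 0 < d)
    (hdN : ∀ᶠ m in atTop, ∀ k, d * numNodes (N m) ≤ N m k) {p q q' : ℝ} (hp : 0 ≤ p) (hq : 0 ≤ q)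
    (hqq' : q < q') {G Gp Gq Gq' : ∀ m, SimpleGraph (Nodes (N m))}
    (hGp : ∀ ε > 0, ∀ᶠ m in atTop, IsNearMean (H m) p ε (Gp m))
    (hGq : ∀ ε > 0, ∀ᶠ m in atTop, IsNearMean (H m) q ε (Gq m))
    (hGq' : ∀ ε > 0, ∀ᶠ m in atTop, IsNearMean (H m) q' ε (Gq' m))
    (hSp : Tendsto (fun m => partialEigSum (r + 1) (laplacian (Gp m)) / (numNodes (N m) : ℝ))
      atTop (𝓝 (r * p)))
    (hSq' : Tendsto (fun m => partialEigSum (r + 1) (laplacian (Gq' m)) / (numNodes (N m) : ℝ))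
      atTop (𝓝 (r * q'))) {δ : ℝ} {b : ℝ≥0∞} (hδ : 0 < δ)
    (hgap : Tendsto (fun m => spectralGap (r + 1) (laplacian (G m)) p) atTop (𝓝 δ))
    (hb : Tendsto (fun m => ENNReal.ofReal
      (frobNorm (laplacian (G m) - laplacian (Gp m)) / (numNodes (N m) : ℝ))) atTop (𝓝 b))
    {Y Z : ∀ m, Matrix (Nodes (N m)) (Fin r) ℝ}
    (hY : ∀ m, IsSpectralEmbedding (K := r + 1) (laplacian (G m)) (Y m))
    (hZ : ∀ m, IsSpectralEmbedding (K := r + 1) (laplacian (Gq m)) (Z m)) :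
    limsup (fun m => ENNReal.ofReal (sinThetaNorm (Y m) (Z m))) atTop ≤
      b / ENNReal.ofReal δ := by
  have hn2 : ∀ m, 2 ≤ numNodes (N m) := fun m =>
    (Nat.succ_le_succ hr).trans (add_one_le_numNodes (hpos m))
  have hn0 : ∀ m, (0 : ℝ) < numNodes (N m) := fun m => Nat.cast_pos.2 (by linarith [hn2 m])
  have hzz : ∀ m j, (fun i => Z m i j) ⬝ᵥ (fun i => Z m i j) = 1 := by
    intro m j
    have := congrFun (congrFun (hZ m).orthonormal j) j
    simpa [dotProduct, Matrix.mul_apply] using this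
  have hzs : ∀ m j, ∑ i, Z m i j = 0 := by
    intro m j
    have := congrFun (hZ m).centered j
    simpa [Matrix.mulVec, dotProduct] using this
  -- The normalized excess of the Rayleigh quotients of `Z` at `p` over `λ_2`; its vanishing is
  -- where `q'` and the cluster proportion `d` enter.
  let η : ℕ → ℝ := fun m => (∑ j, ((fun i => Z m i j) ⬝ᵥ laplacian (Gp m) *ᵥ (fun i => Z m i j)
    - eigval (laplacian (Gp m)) 2)) / numNodes (N m)
  have hη0 : ∀ m, 0 ≤ η m := by
    intro m
    refine div_nonneg (Finset.sum_nonneg fun j _ => sub_nonneg.2 ?_) (hn0 m).le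
    have := eigval_two_mul_le (Gp m) (by rw [card_nodes]; exact hn2 m) (hzs m j)
    rwa [hzz, mul_one] at this
  have hηle : ∀ ε > 0, ∀ᶠ m in atTop, η m ≤ r * (4 * (ε + 4 * ε / ((q' - q) * d))) := by
    intro ε hε
    filter_upwards [hdN, hGp ε hε, hGq ε hε, hGq' ε hε,
      eventually_eigval_two_bounds hr hpos hp hGp hSp hε,
      eventually_eigval_two_bounds hr hpos (hq.trans hqq'.le) hGq' hSq' hε]
      with m h1 h2 h3 h4 h5 h6
    rw [div_le_iff₀ (hn0 m)]
    calc _ ≤ ∑ _j : Fin r, 4 * numNodes (N m) * (ε + 4 * ε / ((q' - q) * d)) := by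
          refine Finset.sum_le_sum fun j _ => ?_
          refine (h2.dotProduct_sub_le (hpos m) (hn2 m) hp hε.le h5.1 (hzs m j) (hzz m j)).trans ?_
          refine mul_le_mul_of_nonneg_left ?_ (by positivity)
          refine add_le_add le_rfl ?_
          have hLz : laplacian (Gq m) *ᵥ (fun i => Z m i j) =
              eigval (laplacian (Gq m)) (j.1 + 2) • fun i => Z m i j := by
            ext k
            have := congrFun (congrFun (hZ m).eigen k) j
            rw [Matrix.mul_diagonal] at this
            rw [Pi.smul_apply, smul_eq_mul, mul_comm, ← this]
            rfl
          have hR : (fun i => Z m i j) ⬝ᵥ laplacian (Gq m) *ᵥ (fun i => Z m i j) ≤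
              (q + ε) * numNodes (N m) := by
            rw [hLz, dotProduct_smul, hzz, smul_eq_mul, mul_one]
            refine (eigval_mono (isHermitian_laplacian _) (by omega) (by omega) ?_).trans
              (h3.eigval_le (hpos m) hq)
            rw [card_nodes]
            exact add_one_le_numNodes (hpos m)
          have h7 := mul_weightedSq_le h3 h4 (hpos m) (hn2 m) hε.le h6.1 (hzs m j) (hzz m j) hR
          set w := (fun i => Z m i j) - clusterMean (fun i => Z m i j)
          have h8 := mul_dotProduct_self_le_weightedSq h1 w
          have hqd : 0 < (q' - q) * d := mul_pos (sub_pos.2 hqq') hd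
          rw [le_div_iff₀ hqd]
          have h9 := (mul_le_mul_of_nonneg_left h8 (sub_nonneg.2 hqq'.le)).trans h7
          refine le_of_mul_le_mul_right ?_ (hn0 m)
          linarith
      _ = _ := by
          rw [Finset.sum_const, Finset.card_univ, Fintype.card_fin, nsmul_eq_mul]
          ring
  have hη : Tendsto η atTop (𝓝 0) := by
    refine tendsto_order.2 ⟨fun a ha => Eventually.of_forall fun m => ha.trans_le (hη0 m),
      fun a ha => ?_⟩
    have hC : 0 < r * (4 * (1 + 4 / ((q' - q) * d))) := by
      have : 0 < (q' - q) * d := mul_pos (sub_pos.2 hqq') hd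
      have : (0 : ℝ) < r := Nat.cast_pos.2 hr
      positivity
    set C := r * (4 * (1 + 4 / ((q' - q) * d))) with hCdef
    filter_upwards [hηle (a / 2 / C) (by positivity)] with m hm
    have e : r * (4 * (a / 2 / C + 4 * (a / 2 / C) / ((q' - q) * d))) = a / 2 / C * C := by
      rw [hCdef]; ring
    rw [e, div_mul_cancel₀ _ hC.ne'] at hm
    linarith
  have hτ : Tendsto (fun m => |eigval (laplacian (Gp m)) 2 / numNodes (N m) - p|) atTop (𝓝 0) := by
    refine tendsto_order.2 ⟨fun a ha => Eventually.of_forall fun m => ha.trans_le (abs_nonneg _),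
      fun a ha => ?_⟩
    filter_upwards [eventually_eigval_two_bounds hr hpos hp hGp hSp (half_pos ha)] with m hm
    rw [← le_div_iff₀ (hn0 m), ← div_le_iff₀ (hn0 m)] at hm
    refine lt_of_le_of_lt (abs_le.2 ⟨?_, ?_⟩) (half_lt_self ha) <;> linarith [hm.1, hm.2]
  refine limsup_ofReal_le_div (h := fun m => √(2 * η m)) hδ hgap hτ ?_ hb
    (fun m => div_nonneg (frobNorm_nonneg _) (hn0 m).le) (fun m => Real.sqrt_nonneg _) ?_
  · have := (hη.const_mul 2).sqrt
    simpa using this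
  -- `λ_{K+1}` is a genuine eigenvalue only for `n ≥ r + 2`; otherwise `eigval` has its default
  -- value 0.
  · filter_upwards [hn.eventually_ge_atTop (r + 2)] with m hm
    have key := abs_sub_mul_sinThetaNorm_le (G := G m) (G' := Gp m) (by rw [card_nodes]; exact hm)
      (hY m) (hZ m).orthonormal (hZ m).centered
    rw [card_nodes] at key
    set n : ℝ := (numNodes (N m) : ℝ)
    have hnm : 0 < n := hn0 m
    have e1 : √(2 * n * ∑ j, ((fun i => Z m i j) ⬝ᵥ laplacian (Gp m) *ᵥ (fun i => Z m i j)
        - eigval (laplacian (Gp m)) 2)) = n * √(2 * η m) := by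
      rw [← Real.sqrt_sq hnm.le, ← Real.sqrt_mul (sq_nonneg n), Real.sqrt_sq hnm.le]
      congr 1
      simp only [η]
      generalize ∑ j, ((fun i => Z m i j) ⬝ᵥ laplacian (Gp m) *ᵥ (fun i => Z m i j)
        - eigval (laplacian (Gp m)) 2) = T
      change 2 * n * T = n ^ 2 * (2 * (T / n))
      field_simp
    rw [e1] at key
    have h1 : spectralGap (r + 1) (laplacian (G m)) p ≤
        |eigval (laplacian (G m)) (r + 2) / n - p| := by
      rw [spectralGap, card_nodes]
      exact min_le_right _ _
    have h2 : |eigval (laplacian (G m)) (r + 2) / n - p| ≤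
        |eigval (laplacian (G m)) (r + 2) - eigval (laplacian (Gp m)) 2| / n +
          |eigval (laplacian (Gp m)) 2 / n - p| := by
      rw [← abs_of_pos hnm, ← abs_div, abs_of_pos hnm, sub_div]
      exact abs_sub_le _ _ _
    have h3 : 0 ≤ sinThetaNorm (Y m) (Z m) := frobNorm_nonneg _
    calc _ ≤ |eigval (laplacian (G m)) (r + 2) - eigval (laplacian (Gp m)) 2| / n *
          sinThetaNorm (Y m) (Z m) := mul_le_mul_of_nonneg_right (by linarith) h3
      _ = |eigval (laplacian (G m)) (r + 2) - eigval (laplacian (Gp m)) 2| *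
          sinThetaNorm (Y m) (Z m) / n := by ring
      _ ≤ (frobNorm (laplacian (G m) - laplacian (Gp m)) + n * √(2 * η m)) / n := by gcongr
      _ = _ := by field_simp

end Asymptotics

/-- The spectral embedding of `L` is compared with that of a subcritical homogeneous RIM at `q`;
the parameter `p` at which the bound is taken may be a different one. -/
theorem ae_limsup_sinThetaNorm_le {Ω : Type*} [MeasurableSpace Ω] {μ : Measure Ω}
    [IsProbabilityMeasure μ] {r : ℕ} (hr : 1 ≤ r) {N : ℕ → Fin (r + 1) → ℕ}
    (hNinj : Function.Injective N) (hN : ∀ k, Tendsto (fun m => N m k) atTop atTop)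
    {c : ℝ} (hc : 0 < c)
    (hratio : Tendsto (fun m => (⨅ k, (N m k : ℝ)) / (⨆ k, (N m k : ℝ))) atTop (𝓝 c))
    {Γ : ∀ m, Ω → SimpleGraph (Nodes (N m))} {H : ∀ m k, SimpleGraph (Fin (N m k))}
    {Γt : ℝ → ∀ m, Ω → SimpleGraph (Nodes (N m))}
    (hΓt : ∀ p ∈ Icc (0 : ℝ) 1, ∀ m, IsRIM μ (H m) (fun _ _ => p) (Γt p m))
    {p q : ℝ} (hp : p ∈ Icc (0 : ℝ) 1) (hpc : p < criticalThreshold N H)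
    (hq : q ∈ Icc (0 : ℝ) 1) (hqc : q < criticalThreshold N H) {b : ℝ≥0∞} {δ : ℝ}
    (hlim : HasLimits μ Γ (Γt p) p b δ) :
    ∀ᵐ ω ∂μ, ∀ Y Z : ∀ m, Matrix (Nodes (N m)) (Fin r) ℝ,
      (∀ m, IsSpectralEmbedding (K := r + 1) (laplacian (Γ m ω)) (Y m)) →
      (∀ m, IsSpectralEmbedding (K := r + 1) (laplacian (Γt q m ω)) (Z m)) →
      limsup (fun m => ENNReal.ofReal (sinThetaNorm (Y m) (Z m))) atTop
        ≤ b / ENNReal.ofReal δ := by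
  have hpos : ∀ m k, 0 < N m k := fun m k =>
    Fin.pos_iff_nonempty.2 ((hΓt p hp m).connected k).nonempty
  have hpos' : ∀ m, 0 < numNodes (N m) := fun m =>
    (Nat.succ_pos r).trans_le (add_one_le_numNodes (hpos m))
  have hn : Tendsto (fun m => numNodes (N m)) atTop atTop :=
    tendsto_atTop_mono (fun m => Finset.single_le_sum (f := N m) (fun _ _ => Nat.zero_le _)
      (Finset.mem_univ 0)) (hN 0)
  obtain ⟨d, hd, hdN⟩ := exists_pos_mul_numNodes_le hpos hc hratio
  obtain ⟨hsp, -⟩ := exists_isSubcritical_of_lt hp.1 hpc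
  obtain ⟨-, q', hq', hqq', hsq'⟩ := exists_isSubcritical_of_lt hq.1 hqc
  obtain ⟨hδ, hgap, hb⟩ := hlim
  have hr' : (((r + 1 : ℕ) : ℝ) - 1) = r := by push_cast; ring
  filter_upwards [hgap, hb, ae_eventually_abs_sub_le hNinj hpos' hp (hΓt p hp),
    ae_eventually_abs_sub_le hNinj hpos' hq (hΓt q hq),
    ae_eventually_abs_sub_le hNinj hpos' hq' (hΓt q' hq'),
    hsp.ae_tendsto (hΓt p hp), hsq'.ae_tendsto (hΓt q' hq')]
    with ω h1 h2 h3 h4 h5 h6 h7 Y Z hY hZ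
  rw [hr'] at h6 h7
  exact limsup_sinThetaNorm_le hr hpos hn hd hdN hp.1 hq.1 hqq' h3 h4 h5 h6 h7 hδ h1 h2 hY hZ

theorem theorem3 {Ω : Type*} [MeasurableSpace Ω] (μ : Measure Ω) [IsProbabilityMeasure μ]
    (K : ℕ) (hK : 2 ≤ K)
    -- the cluster sizes, along a sequence of pairwise different size vectors
    (N : ℕ → Fin K → ℕ) (hNinj : Function.Injective N)
    (hN : ∀ k, Tendsto (fun m => N m k) atTop atTop)
    (c : ℝ) (hc : 0 < c)
    (hratio : Tendsto (fun m => (⨅ k, (N m k : ℝ)) / (⨆ k, (N m k : ℝ))) atTop (𝓝 c))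
    -- the graphs with Laplacian `L`
    (G : ∀ m k, SimpleGraph (Fin (N m k)))
    (P : Fin K → Fin K → ℝ) (hPsymm : ∀ i j, P i j = P j i)
    (hP : ∀ i j, i ≠ j → P i j ∈ Icc (0 : ℝ) 1)
    (Γ : ∀ m, Ω → SimpleGraph (Nodes (N m))) (hΓ : ∀ m, IsRIM μ (G m) P (Γ m))
    -- the graphs with Laplacian `L̃`, for every parameter `p`
    (H : ∀ m k, SimpleGraph (Fin (N m k)))
    (Γt : ℝ → ∀ m, Ω → SimpleGraph (Nodes (N m)))
    (hΓt : ∀ p ∈ Icc (0 : ℝ) 1, ∀ m, IsRIM μ (H m) (fun _ _ => p) (Γt p m))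
    (hindep : ∀ p ∈ Icc (0 : ℝ) 1, ∀ m,
      IndepFun (fun ω u v => (Γ m ω).Adj u v) (fun ω u v => (Γt p m ω).Adj u v) μ)
    (b : ℝ → ℝ≥0∞) (δ : ℝ → ℝ) :
    (∀ p ∈ Icc (0 : ℝ) 1, p < criticalThreshold N H → HasLimits μ Γ (Γt p) p (b p) (δ p) →
      ∀ᵐ ω ∂μ, ∀ Y Z : ∀ m, Matrix (Nodes (N m)) (Fin (K - 1)) ℝ,
        (∀ m, IsSpectralEmbedding (laplacian (Γ m ω)) (Y m)) →
        (∀ m, IsSpectralEmbedding (laplacian (Γt p m ω)) (Z m)) →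
        limsup (fun m => ENNReal.ofReal (sinThetaNorm (Y m) (Z m))) atTop
          ≤ b p / ENNReal.ofReal (δ p)) ∧
    (maxProb P < criticalThreshold N H →
      ∀ q ∈ Icc (0 : ℝ) 1, q < criticalThreshold N H →
      ∀ᵐ ω ∂μ, ∀ Y Z : ∀ m, Matrix (Nodes (N m)) (Fin (K - 1)) ℝ,
        (∀ m, IsSpectralEmbedding (laplacian (Γ m ω)) (Y m)) →
        (∀ m, IsSpectralEmbedding (laplacian (Γt q m ω)) (Z m)) →
        limsup (fun m => ENNReal.ofReal (sinThetaNorm (Y m) (Z m))) atTop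
          ≤ ⨅ p ∈ {p : ℝ | p ∈ Icc (0 : ℝ) 1 ∧ p ≤ maxProb P ∧
                HasLimits μ Γ (Γt p) p (b p) (δ p)},
              b p / ENNReal.ofReal (δ p)) := by
  obtain ⟨r, rfl⟩ : ∃ r, K = r + 1 := ⟨K - 1, by omega⟩
  have hr : 1 ≤ r := by omega
  refine ⟨fun p hp hpc hlim =>
    ae_limsup_sinThetaNorm_le hr hNinj hN hc hratio hΓt hp hpc hp hpc hlim, fun hmax q hq hqc => ?_⟩
  set T := {p : ℝ | p ∈ Icc (0 : ℝ) 1 ∧ p ≤ maxProb P ∧ HasLimits μ Γ (Γt p) p (b p) (δ p)}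
  rcases T.eq_empty_or_nonempty with hT | hT
  -- Without admissible values the infimum is `∞`.
  · simp [hT]
  -- The exceptional null set depends on `p`, and admissible values may be uncountable; a minimizing
  -- sequence leaves countably many null sets.
  obtain ⟨u, -, hu, hmem⟩ := exists_seq_tendsto_sInf (hT.image fun p => b p / ENNReal.ofReal (δ p))
    (OrderBot.bddBelow _)
  choose p hpT hpu using hmem
  have h : ∀ i, ∀ᵐ ω ∂μ, ∀ Y Z : ∀ m, Matrix (Nodes (N m)) (Fin r) ℝ,
      (∀ m, IsSpectralEmbedding (K := r + 1) (laplacian (Γ m ω)) (Y m)) →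
      (∀ m, IsSpectralEmbedding (K := r + 1) (laplacian (Γt q m ω)) (Z m)) →
      limsup (fun m => ENNReal.ofReal (sinThetaNorm (Y m) (Z m))) atTop
        ≤ b (p i) / ENNReal.ofReal (δ (p i)) := fun i =>
    ae_limsup_sinThetaNorm_le hr hNinj hN hc hratio hΓt (hpT i).1
      ((hpT i).2.1.trans_lt hmax) hq hqc (hpT i).2.2
  filter_upwards [ae_all_iff.2 h] with ω hω Y Z hY hZ
  rw [← sInf_image]
  refine ge_of_tendsto' hu fun i => ?_
  rw [← hpu i]
  exact hω i Y Z hY hZ
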